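/- For $y\in\mathbb R$ let $\mathfrak{su}_{\rm ext}^{(y)}(2)$ be the four-dimensional real Lie algebra with basis $J_0,J_1,J_2,J_3$, where $J_0$ is central and $$[J_1,J_2]=2J_3,\qquad [J_2,J_3]=2yJ_1+2J_0,\qquad [J_3,J_1]=2J_2 .$$ Let $\mathfrak A_{\mathbb R}$ be the Lie algebroid over $\mathbb R$ given by the trivial vector bundle with fibre $\mathfrak{su}_{\rm ext}^{(y)}(2)$ at $y$, the zero anchor and the pointwise bracket of sections. Let $\operatorname{Arg}$ be the $(-\pi,\pi)$-valued argument on $\mathbb C\setminus(-\infty,0]$, and for $m\in M_2(\mathbb C)$ write $a(m)=m_{11}$, $b(m)=m_{12}$. For $y\in\mathbb R$ let $$G_y=\left\{\begin{pmatrix} a& b\\ -y\bar b&\bar a\end{pmatrix}\ \middle|\ a,b\in\mathbb C,\ a \notin (-\infty,0],\ |a|^2+y|b|^2=1,\ -\tfrac{\pi}{3}<\operatorname{Arg}(a)<\tfrac{\pi}{3}\right\}\subseteq SL(2,\mathbb C),$$ and for $g,h\in G_y$ with $gh\in G_y$ let $$\Omega_y(g,h)=\frac1y\operatorname{Arg}\!\left(\frac{a(gh)}{a(g)a(h)}\right)\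 (y\neq0),\qquad \Omega_0(g,h)=\operatorname{Im}\!\left(-\frac{b(g)\overline{b(h)}}{a(g)a(h)}\right).$$ Let $\widetilde G_y=\mathbb R\times G_y$ with the partial multiplication $(r,g)(s,h)=(r+s+\Omega_y(g,h),\,gh)$, defined when $gh\in G_y$, with unit $(0,1)$ and inversion $(r,g)\mapsto(-r,g^{-1})$. Put $$A_{\mathbb R}=\{(y,r,g)\mid (r,g)\in\widetilde G_y\}\subseteq\mathbb R\times\mathbb R\times SL(2,\mathbb C).$$ Then $A_{\mathbb R}$ is a $5$-dimensional embedded smooth submanifold of $\mathbb R\times\mathbb R\times M_2(\mathbb C)$, and with the projection $(y,r,g)\mapsto y$ and the above fibrewise operations it is a smooth bundle of local Lie groups over $\mathbb R$. That is: the projection is a surjective smooth submersion; the unit section and the inversion are smooth; the multiplication is defined on an open subset of the fibre product $A_{\mathbb R}\times_{\mathbb R}A_{\mathbb R}$ (containing all pairs of an element with the unit of its fibre or with its inverse) and is smooth there; the unit and inverse laws hold; and $(gh)k=g(hk)$ whenever the products $gh$, $hk$, $(gh)k$, $g(hk)$ are all defined. Moreover, the Lie algebroid of $A_{\mathbb R}$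 is $\mathfrak A_{\mathbb R}$. That is, there is a smooth vector bundle isomorphism from $\mathfrak A_{\mathbb R}$ onto the restriction to the unit section of the kernel of the differential of the projection, which intertwines the anchors and takes the bracket of sections of $\mathfrak A_{\mathbb R}$ to the Lie bracket of the corresponding left-invariant vector fields on $A_{\mathbb R}$ (which are smooth). In fact the isomorphism may be chosen so that, at $y$, it sends $J_0,J_1,J_2,J_3$ to the vectors tangent to $\mathbb R\times G_y$ at $(0,1)$ $$(1,0),\quad \left(0,\begin{pmatrix} i&0\\0&-i\end{pmatrix}\right),\quad \left(0,\begin{pmatrix}0&1\\-y&0\end{pmatrix}\right),\quad \left(0,\begin{pmatrix}0&i\\ iy&0\end{pmatrix}\right).$$ -/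

import Mathlib

open scoped Manifold ContDiff ComplexConjugate

/-! ## Lie algebroids -/

section LieAlgebroids

open Bundle

/-- The product `f Y` of a smooth function and a smooth section of a vector bundle. -/
noncomputable def smulSection {E H B F : Type*} [NormedAddCommGroup E] [NormedSpace ℝ E] [TopologicalSpace H]
    {J : ModelWithCorners ℝ E H} [TopologicalSpace B] [ChartedSpace H B]
    [NormedAddCommGroup F] [NormedSpace ℝ F]
    {V : B → Type*} [TopologicalSpace (TotalSpace F V)] [∀ b, AddCommGroup (V b)]
    [∀ b, Module ℝ (V b)] [∀ b, TopologicalSpace (V b)] [FiberBundle F V] [VectorBundle ℝ F V]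
    (f : C^∞⟮J, B; ℝ⟯) (Y : Cₛ^∞⟮J; F, V⟯) : Cₛ^∞⟮J; F, V⟯ where
  toFun b := f b • Y b
  contMDiff_toFun := f.contMDiff.smul_section Y.contMDiff

/-- The derivative of a real function `f` along a tangent vector `v` at `b`. -/
noncomputable def derivAlong {E H B : Type*} [NormedAddCommGroup E] [NormedSpace ℝ E]
    [TopologicalSpace H] (J : ModelWithCorners ℝ E H) [TopologicalSpace B] [ChartedSpace H B]
    (f : B → ℝ) (b : B) (v : TangentSpace J b) : ℝ :=
  mfderiv J 𝓘(ℝ, ℝ) f b v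

/-- A Lie algebroid structure on a smooth real vector bundle `V` (with model fibre `F`) over a
manifold `B`: a smooth bundle map `anchor : V → TB` and a Lie bracket on the space of smooth
sections, satisfying `[X, f Y] = f [X, Y] + anchor(X)(f) Y`. -/
structure LieAlgebroid {E H B : Type*} [NormedAddCommGroup E] [NormedSpace ℝ E]
    [TopologicalSpace H] (J : ModelWithCorners ℝ E H) [TopologicalSpace B] [ChartedSpace H B]
    [IsManifold J ∞ B]
    (F : Type*) [NormedAddCommGroup F] [NormedSpace ℝ F]
    (V : B → Type*) [TopologicalSpace (TotalSpace F V)] [∀ b, AddCommGroup (V b)]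
    [∀ b, Module ℝ (V b)] [∀ b, TopologicalSpace (V b)] [FiberBundle F V] [VectorBundle ℝ F V]
    [ContMDiffVectorBundle ∞ F V J] where
  anchor : ∀ b : B, V b →ₗ[ℝ] TangentSpace J b
  contMDiff_anchor : ContMDiff (J.prod 𝓘(ℝ, F)) J.tangent ∞
    (fun p : TotalSpace F V => (⟨p.proj, anchor p.proj p.snd⟩ : TangentBundle J B))
  bracket : Cₛ^∞⟮J; F, V⟯ →ₗ[ℝ] Cₛ^∞⟮J; F, V⟯ →ₗ[ℝ] Cₛ^∞⟮J; F, V⟯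
  bracket_self : ∀ X, bracket X X = 0
  jacobi : ∀ X Y Z,
    bracket X (bracket Y Z) = bracket (bracket X Y) Z + bracket Y (bracket X Z)
  leibniz : ∀ (X : Cₛ^∞⟮J; F, V⟯) (f : C^∞⟮J, B; ℝ⟯) (Y : Cₛ^∞⟮J; F, V⟯) (b : B),
    bracket X (smulSection f Y) b =
      f b • bracket X Y b + derivAlong J f b (anchor b (X b)) • Y b

end LieAlgebroids

/-! ## Bundles of local Lie groups -/

/-- The raw data of a bundle of local groups with total space `M` and base `B`: the projection,
the unit section, the domain of multiplication, the multiplication, the domain of inversion and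
the inversion. The values of `mul` outside `mulDom` and of `inv` outside `invDom` are irrelevant. -/
structure LocalGroupBundleData (M B : Type*) where
  proj : M → B
  unit : B → M
  mulDom : Set (M × M)
  mul : M → M → M
  invDom : Set M
  inv : M → M

namespace LocalGroupBundleData

variable {E H M E' H' B : Type*}
  [NormedAddCommGroup E] [NormedSpace ℝ E] [TopologicalSpace H]
  [TopologicalSpace M] [ChartedSpace H M]
  [NormedAddCommGroup E'] [NormedSpace ℝ E'] [TopologicalSpace H']
  [TopologicalSpace B] [ChartedSpace H' B]

/-- The data `𝒢` form a smooth bundle of local Lie groups, i.e. a local Lie groupoid whose source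
and target maps coincide with a surjective submersion `proj : M → B`.

The product is defined on an open part of the fibre product `M ×_B M`, which is an embedded
submanifold of `M × M`; smoothness of the product is smoothness on this subset of `M × M`. -/
structure IsLocalLieGroupBundle (I : ModelWithCorners ℝ E H) (J : ModelWithCorners ℝ E' H')
    (𝒢 : LocalGroupBundleData M B) : Prop where
  isSubmersion_proj : Manifold.IsSubmersion I J ∞ 𝒢.proj
  contMDiff_proj : ContMDiff I J ∞ 𝒢.proj
  contMDiff_unit : ContMDiff J I ∞ 𝒢.unit
  proj_unit : ∀ b, 𝒢.proj (𝒢.unit b) = b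
  mulDom_open : ∃ W : Set (M × M), IsOpen W ∧
    𝒢.mulDom = W ∩ {p | 𝒢.proj p.1 = 𝒢.proj p.2}
  contMDiffOn_mul : ContMDiffOn (I.prod I) I ∞ (fun p : M × M => 𝒢.mul p.1 p.2) 𝒢.mulDom
  proj_mul : ∀ g h, (g, h) ∈ 𝒢.mulDom → 𝒢.proj (𝒢.mul g h) = 𝒢.proj g
  unit_mul : ∀ g, (𝒢.unit (𝒢.proj g), g) ∈ 𝒢.mulDom ∧ 𝒢.mul (𝒢.unit (𝒢.proj g)) g = g
  mul_unit : ∀ g, (g, 𝒢.unit (𝒢.proj g)) ∈ 𝒢.mulDom ∧ 𝒢.mul g (𝒢.unit (𝒢.proj g)) = g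
  mul_assoc : ∀ g h k, (g, h) ∈ 𝒢.mulDom → (h, k) ∈ 𝒢.mulDom →
    (𝒢.mul g h, k) ∈ 𝒢.mulDom → (g, 𝒢.mul h k) ∈ 𝒢.mulDom →
    𝒢.mul (𝒢.mul g h) k = 𝒢.mul g (𝒢.mul h k)
  isOpen_invDom : IsOpen 𝒢.invDom
  unit_mem_invDom : ∀ b, 𝒢.unit b ∈ 𝒢.invDom
  contMDiffOn_inv : ContMDiffOn I I ∞ 𝒢.inv 𝒢.invDom
  inv_mul : ∀ g ∈ 𝒢.invDom,
    (𝒢.inv g, g) ∈ 𝒢.mulDom ∧ 𝒢.mul (𝒢.inv g) g = 𝒢.unit (𝒢.proj g)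
  mul_inv : ∀ g ∈ 𝒢.invDom,
    (g, 𝒢.inv g) ∈ 𝒢.mulDom ∧ 𝒢.mul g (𝒢.inv g) = 𝒢.unit (𝒢.proj g)

/-- The vector field on `M` obtained from vectors `ξ b ∈ T_{unit b} M` tangent to the fibres by
infinitesimal left multiplication: its value at `x` in the fibre over `b` is `d(L_x)_{unit b} (ξ b)`,
where `L_x : h ↦ x h` is defined on an open neighbourhood of `unit b` in this fibre. (The derivative
is taken within this part of the fibre; its value on vectors tangent to the fibre is therefore
determined. One uses `x (unit b) = x` to regard the result as a vector at `x`.) -/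
noncomputable def leftInvariantField (I : ModelWithCorners ℝ E H) (𝒢 : LocalGroupBundleData M B)
    (ξ : ∀ b : B, TangentSpace I (𝒢.unit b)) : ∀ x : M, TangentSpace I x := fun x =>
  id (α := E) (mfderivWithin I I (𝒢.mul x) {h | (x, h) ∈ 𝒢.mulDom} (𝒢.unit (𝒢.proj x))
    (ξ (𝒢.proj x)))

/-- `Φ` exhibits the Lie algebroid `𝒜` on `V` as the Lie algebroid of the bundle of local Lie
groups `𝒢`: it is a smooth isomorphism of `V` with the restriction to the units of the kernel of
the derivative of the source map, it intertwines the anchor with the derivative of the target map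
(both maps are `proj`), and it carries the bracket of `𝒜` to the bracket of left invariant vector
fields. -/
structure IsLieAlgebroidIso {I : ModelWithCorners ℝ E H} {J : ModelWithCorners ℝ E' H'}
    [IsManifold I ∞ M] [IsManifold J ∞ B]
    {F : Type*} [NormedAddCommGroup F] [NormedSpace ℝ F]
    {V : B → Type*} [TopologicalSpace (Bundle.TotalSpace F V)] [∀ b, AddCommGroup (V b)]
    [∀ b, Module ℝ (V b)] [∀ b, TopologicalSpace (V b)] [FiberBundle F V] [VectorBundle ℝ F V]
    [ContMDiffVectorBundle ∞ F V J]
    (𝒢 : LocalGroupBundleData M B) (𝒜 : LieAlgebroid J F V)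
    (Φ : ∀ b : B, V b →ₗ[ℝ] TangentSpace I (𝒢.unit b)) : Prop where
  contMDiff : ContMDiff (J.prod 𝓘(ℝ, F)) I.tangent ∞
    (fun p : Bundle.TotalSpace F V => (⟨𝒢.unit p.proj, Φ p.proj p.snd⟩ : TangentBundle I M))
  injective : ∀ b, Function.Injective (Φ b)
  range_eq : ∀ b w, (∃ v, Φ b v = w) ↔ mfderiv I J 𝒢.proj (𝒢.unit b) w = 0
  anchor_eq : ∀ b v,
    (mfderiv I J 𝒢.proj (𝒢.unit b) (Φ b v) : E') = (𝒜.anchor b v : E')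
  contMDiff_leftInvariantField : ∀ X : Cₛ^∞⟮J; F, V⟯, ContMDiff I I.tangent ∞
    (fun x => (⟨x, 𝒢.leftInvariantField I (fun b => Φ b (X b)) x⟩ : TangentBundle I M))
  bracket_eq : ∀ (X Y : Cₛ^∞⟮J; F, V⟯) (x : M),
    VectorField.mlieBracket I (𝒢.leftInvariantField I (fun b => Φ b (X b)))
        (𝒢.leftInvariantField I (fun b => Φ b (Y b))) x =
      𝒢.leftInvariantField I (fun b => Φ b (𝒜.bracket X Y b)) x

end LocalGroupBundleData

/-! ## The Lie algebras `su_ext^(y)(2)` and the Lie algebroid they form -/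

/-- The bracket of `su_ext^(y)(2)`, in coordinates with respect to the basis `J₀, J₁, J₂, J₃`. -/
def suExtBracket (y : ℝ) (u v : Fin 4 → ℝ) : Fin 4 → ℝ :=
  ![2 * (u 2 * v 3 - u 3 * v 2), 2 * y * (u 2 * v 3 - u 3 * v 2),
    2 * (u 3 * v 1 - u 1 * v 3), 2 * (u 1 * v 2 - u 2 * v 1)]

/-- The basis vector `J_i` of `su_ext^(y)(2)`. -/
def suExtBasis (i : Fin 4) : Fin 4 → ℝ := Pi.single i 1

/-- The defining relations `[J₁,J₂] = 2J₃`, `[J₂,J₃] = 2yJ₁ + 2J₀`, `[J₃,J₁] = 2J₂`, and `J₀` is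
central. -/
theorem suExtBracket_basis (y : ℝ) :
    suExtBracket y (suExtBasis 1) (suExtBasis 2) = (2 : ℝ) • suExtBasis 3 ∧
    suExtBracket y (suExtBasis 2) (suExtBasis 3) =
      (2 * y) • suExtBasis 1 + (2 : ℝ) • suExtBasis 0 ∧
    suExtBracket y (suExtBasis 3) (suExtBasis 1) = (2 : ℝ) • suExtBasis 2 ∧
    ∀ v, suExtBracket y (suExtBasis 0) v = 0 := by
  refine ⟨?_, ?_, ?_, fun v => ?_⟩ <;> ext i <;> fin_cases i <;>
    simp [suExtBracket, suExtBasis]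

theorem suExtBracket_add_left (y : ℝ) (u u' v : Fin 4 → ℝ) :
    suExtBracket y (u + u') v = suExtBracket y u v + suExtBracket y u' v := by
  ext i; fin_cases i <;> simp only [suExtBracket, Pi.add_apply] <;> simp <;> ring

theorem suExtBracket_add_right (y : ℝ) (u v v' : Fin 4 → ℝ) :
    suExtBracket y u (v + v') = suExtBracket y u v + suExtBracket y u v' := by
  ext i; fin_cases i <;> simp only [suExtBracket, Pi.add_apply] <;> simp <;> ring

theorem suExtBracket_smul_left (y c : ℝ) (u v : Fin 4 → ℝ) :
    suExtBracket y (c • u) v = c • suExtBracket y u v := by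
  ext i; fin_cases i <;> simp only [suExtBracket, Pi.smul_apply, smul_eq_mul] <;> simp <;> ring

theorem suExtBracket_smul_right (y c : ℝ) (u v : Fin 4 → ℝ) :
    suExtBracket y u (c • v) = c • suExtBracket y u v := by
  ext i; fin_cases i <;> simp only [suExtBracket, Pi.smul_apply, smul_eq_mul] <;> simp <;> ring

theorem suExtBracket_self (y : ℝ) (u : Fin 4 → ℝ) : suExtBracket y u u = 0 := by
  ext i; fin_cases i <;> simp [suExtBracket, mul_comm]

theorem suExtBracket_jacobi (y : ℝ) (u v w : Fin 4 → ℝ) :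
    suExtBracket y u (suExtBracket y v w) =
      suExtBracket y (suExtBracket y u v) w + suExtBracket y v (suExtBracket y u w) := by
  ext i; fin_cases i <;> simp [suExtBracket] <;> ring

/-- The bracket of sections of the trivial bundle over `ℝ` with fibre `su_ext^(y)(2)` at `y`. -/
noncomputable def suExtSectionBracket (X Y : Cₛ^∞⟮𝓘(ℝ, ℝ); (Fin 4 → ℝ), Bundle.Trivial ℝ (Fin 4 → ℝ)⟯) :
    Cₛ^∞⟮𝓘(ℝ, ℝ); (Fin 4 → ℝ), Bundle.Trivial ℝ (Fin 4 → ℝ)⟯ where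
  toFun y := suExtBracket y (X y) (Y y)
  contMDiff_toFun := by
    have key : ∀ Z : Cₛ^∞⟮𝓘(ℝ, ℝ); (Fin 4 → ℝ), Bundle.Trivial ℝ (Fin 4 → ℝ)⟯,
        ContDiff ℝ ∞ (fun y : ℝ => (Z y : Fin 4 → ℝ)) := fun Z => by
      have h := Z.contMDiff
      exact contDiff_iff_contDiffAt.2 fun y =>
        ((Bundle.contMDiffAt_section _).1 (h y)).contDiffAt
    have hX := contDiff_pi.1 (key X)
    have hY := contDiff_pi.1 (key Y)
    intro y
    refine (Bundle.contMDiffAt_section _).2 (ContDiffAt.contMDiffAt (ContDiff.contDiffAt ?_))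
    change ContDiff ℝ ∞ (fun y : ℝ => suExtBracket y (X y) (Y y))
    have h1 := hX 1
    have h2 := hX 2
    have h3 := hX 3
    have k1 := hY 1
    have k2 := hY 2
    have k3 := hY 3
    refine contDiff_pi.2 fun i => ?_
    fin_cases i <;> simp [suExtBracket] <;> fun_prop

/-- The Lie algebroid `𝔄_ℝ`: the trivial bundle over `ℝ` with fibre `su_ext^(y)(2)` at `y`, with
zero anchor and the pointwise bracket. -/
noncomputable def suExtAlgebroid :
    LieAlgebroid 𝓘(ℝ, ℝ) (Fin 4 → ℝ) (Bundle.Trivial ℝ (Fin 4 → ℝ)) where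
  anchor _ := 0
  contMDiff_anchor :=
    (Bundle.contMDiff_zeroSection ℝ (TangentSpace 𝓘(ℝ, ℝ) : ℝ → Type _)).comp
      (Bundle.contMDiff_proj (Bundle.Trivial ℝ (Fin 4 → ℝ)))
  bracket := LinearMap.mk₂ ℝ suExtSectionBracket
    (fun X X' Y => by ext1 y; exact suExtBracket_add_left y (X y) (X' y) (Y y))
    (fun c X Y => by ext1 y; exact suExtBracket_smul_left y c (X y) (Y y))
    (fun X Y Y' => by ext1 y; exact suExtBracket_add_right y (X y) (Y y) (Y' y))
    (fun c X Y => by ext1 y; exact suExtBracket_smul_right y c (X y) (Y y))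
  bracket_self X := by ext1 y; exact suExtBracket_self y (X y)
  jacobi X Y Z := by ext1 y; exact suExtBracket_jacobi y (X y) (Y y) (Z y)
  leibniz X f Y y := by
    have h : derivAlong 𝓘(ℝ, ℝ) f y 0 = 0 := map_zero (mfderiv 𝓘(ℝ, ℝ) 𝓘(ℝ, ℝ) f y)
    refine (suExtBracket_smul_right y (f y) (X y) (Y y)).trans ?_
    rw [LinearMap.zero_apply, h, zero_smul, add_zero]
    rfl

/-! ## The bundle `A_ℝ` -/

/-- The subset `G_y` of `SL(2, ℂ)`. (The condition `a ≠ 0` is part of the requirement that the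
argument of `a` is defined.) -/
def contractionG (y : ℝ) : Set (Matrix.SpecialLinearGroup (Fin 2) ℂ) :=
  {g | ∃ a b : ℂ, (g : Matrix (Fin 2) (Fin 2) ℂ) = !![a, b; -(y : ℂ) * conj b, conj a] ∧
    ‖a‖ ^ 2 + y * ‖b‖ ^ 2 = 1 ∧ a ≠ 0 ∧ -(Real.pi / 3) < a.arg ∧ a.arg < Real.pi / 3}

theorem one_mem_contractionG (y : ℝ) : 1 ∈ contractionG y := by
  refine ⟨1, 0, ?_, ?_, ?_, ?_, ?_⟩
  · simp [Matrix.one_fin_two]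
  · simp
  · simp
  · simpa using Real.pi_pos
  · simpa using Real.pi_pos

theorem inv_mem_contractionG {y : ℝ} {g : Matrix.SpecialLinearGroup (Fin 2) ℂ}
    (hg : g ∈ contractionG y) : g⁻¹ ∈ contractionG y := by
  obtain ⟨a, b, h, h1, h0, h2, h3⟩ := hg
  have hne : a.arg ≠ Real.pi := by linarith [Real.pi_pos]
  refine ⟨conj a, -b, ?_, ?_, ?_, ?_, ?_⟩
  · rw [Matrix.SpecialLinearGroup.coe_inv, h, Matrix.adjugate_fin_two_of]
    simp
  · simpa using h1
  · simpa using h0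
  · rw [Complex.arg_conj, if_neg hne]; linarith
  · rw [Complex.arg_conj, if_neg hne]; linarith

/-- The function `Ω_y` on pairs of elements of `G_y` with product in `G_y`. -/
noncomputable def contractionOmega (y : ℝ) (g h : Matrix.SpecialLinearGroup (Fin 2) ℂ) : ℝ :=
  if y = 0 then (-(g 0 1 * conj (h 0 1)) / (g 0 0 * h 0 0)).im
  else (1 / y) * ((g * h) 0 0 / (g 0 0 * h 0 0)).arg

/-- The set `A_ℝ` of triples `(y, r, g)` with `(r, g) ∈ ℝ × G_y`, as a topological subspace of
`ℝ × ℝ × SL(2, ℂ)`. -/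
def contractionBundle : Set (ℝ × ℝ × Matrix.SpecialLinearGroup (Fin 2) ℂ) :=
  {p | p.2.2 ∈ contractionG p.1}

open scoped Classical in
/-- The fibrewise operations on `A_ℝ`: over each `y`, the product
`(r, g) (s, h) = (r + s + Ω_y(g, h), g h)`, defined when `g h ∈ G_y`, with unit `(0, 1)` and
inversion `(r, g) ↦ (-r, g⁻¹)`. -/
noncomputable def contractionData : LocalGroupBundleData contractionBundle ℝ where
  proj x := x.1.1
  unit y := ⟨(y, 0, 1), one_mem_contractionG y⟩
  mulDom := {p | p.1.1.1 = p.2.1.1 ∧ p.1.1.2.2 * p.2.1.2.2 ∈ contractionG p.1.1.1}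
  mul x x' :=
    if h : x.1.2.2 * x'.1.2.2 ∈ contractionG x.1.1 then
      ⟨(x.1.1, x.1.2.1 + x'.1.2.1 + contractionOmega x.1.1 x.1.2.2 x'.1.2.2,
        x.1.2.2 * x'.1.2.2), h⟩
    else x
  invDom := Set.univ
  inv x := ⟨(x.1.1, -x.1.2.1, x.1.2.2⁻¹), inv_mem_contractionG x.2⟩

/-- The inclusion of `A_ℝ` in the vector space `ℝ × ℝ × M₂(ℂ)`. -/
def contractionIncl (x : contractionBundle) : ℝ × ℝ × (Fin 2 → Fin 2 → ℂ) :=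
  (x.1.1, x.1.2.1, fun i j => x.1.2.2 i j)

/-- The tangent vectors `J₀ = (1, 0)`, `J₁`, `J₂`, `J₃` of `ℝ × G_y` at its unit, as elements of
`ℝ × M₂(ℂ)`. -/
noncomputable def contractionTangent (y : ℝ) : Fin 4 → ℝ × (Fin 2 → Fin 2 → ℂ) :=
  ![(1, 0),
    (0, ![![Complex.I, 0], ![0, -Complex.I]]),
    (0, ![![0, 1], ![-(y : ℂ), 0]]),
    (0, ![![0, Complex.I], ![Complex.I * y, 0]])]

/-! ### Calculus on a manifold with a single chart -/

section SingleChart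

open Set Filter Topology

variable {E M : Type*} [NormedAddCommGroup E] [NormedSpace ℝ E] [TopologicalSpace M]
  [ChartedSpace E M] {e : OpenPartialHomeomorph M E}

/-! Everything becomes explicit in one global chart. The determinant condition says |a|² = 1 -
y|b|², so a point of `A_ℝ` is determined by (y, r, θ, b) with θ = arg a and a = √(1 - y|b|²)
exp(iθ). These coordinates fill the open set `BundleCoord.domain`, given by y|b|² < 1 and |θ| < π/3.
Replacing a by log a in the ambient space gives a chart in which `A_ℝ` is a linear slice
(`sliceHomeomorph`, `sliceCoord_contractionIncl`).

The only danger to smoothness is Ω at y = 0. Put w = -b(g) conj(b(h)) / (a(g) a(h)). Then a(gh) /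
(a(g) a(h)) = 1 + y w, and both cases of the definition are values of Im(log(1 + y w) / y) with its
removable singularity filled in (`imLogQuot`, `contractionOmega_eq`). The bound π/3 prevents jumps
by 2π: arg a(gh) - arg a(g) - arg a(h) lies in (-π, π), so 1 + y w stays in the slit plane and arg
a(gh) = arg a(g) + arg a(h) + y Ω (`div_mem_slitPlane_of_mem_argSector`, `arg_contractionG_mul`). So
the product is smooth in coordinates. For y ≠ 0, Ω is the coboundary of arg(a) / y, hence a cocycle;
for y = 0 the cocycle identity is a direct computation with |a| = 1. This gives associativity.

For the algebroid, differentiating the product at the unit gives the left invariant fields in closed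
form (`BundleCoord.leftVec`, `BundleCoord.hasDerivAt_mul`). They are tangent to the fibres, so
coefficients depending on y behave as constants under the bracket, and the bracket of two fields is
again left invariant with the coefficients of `suExtBracket` (`BundleCoord.leftVecDeriv_sub`,
`BundleCoord.lieBracket_leftVec`). With a single chart, the manifold notions of derivative and
bracket reduce to those of the model space (`mfderivWithin_eq_of_hasDerivAt`,
`mlieBracket_eq_lieBracket`). -/

theorem extChartAt_eq_of_chartAt_eq (he : ∀ x : M, chartAt E x = e) (x : M) :
    extChartAt 𝓘(ℝ, E) x = e.toPartialEquiv := by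
  simp [extChartAt, he x, OpenPartialHomeomorph.extend]

/-- The derivative of a map between manifolds with a single chart, in terms of curves that are
straight in the chart of the source. -/
theorem mfderivWithin_eq_of_hasDerivAt {E' M' : Type*} [NormedAddCommGroup E'] [NormedSpace ℝ E']
    [TopologicalSpace M'] [ChartedSpace E' M'] {e' : OpenPartialHomeomorph M' E'}
    (he : ∀ x : M, chartAt E x = e) (he' : ∀ x : M', chartAt E' x = e')
    {f : M → M'} {s : Set M} {x : M} (hf : MDifferentiableWithinAt 𝓘(ℝ, E) 𝓘(ℝ, E') f s x)
    {v : E} {w : E'} (hs : ∀ᶠ t : ℝ in 𝓝 0, e.symm (e x + t • v) ∈ s)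
    (h : HasDerivAt (fun t : ℝ => e' (f (e.symm (e x + t • v)))) w 0) :
    (mfderivWithin 𝓘(ℝ, E) 𝓘(ℝ, E') f s x : E →L[ℝ] E') v = w := by
  have h1 := hf.hasMFDerivWithinAt.2
  simp only [writtenInExtChartAt, extChartAt_eq_of_chartAt_eq he,
    extChartAt_eq_of_chartAt_eq he'] at h1
  have hγ : HasDerivAt (fun t : ℝ => e x + t • v) v 0 := by
    simpa using ((hasDerivAt_id (0 : ℝ)).smul_const v).const_add (e x)
  have h2 : HasDerivWithinAt (fun t : ℝ => e' (f (e.symm (e x + t • v))))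
      ((mfderivWithin 𝓘(ℝ, E) 𝓘(ℝ, E') f s x : E →L[ℝ] E') v)
      {t | e.symm (e x + t • v) ∈ s} 0 := by
    refine HasFDerivWithinAt.comp_hasDerivWithinAt_of_eq (0 : ℝ) h1 hγ.hasDerivWithinAt ?_ ?_
    · intro t ht
      exact ⟨ht, by simp⟩
    · simp
  -- Uniqueness of derivatives is used only on ℝ: the curve stays in `s` for small times. So `s` may
  -- be a piece of a fibre, where the derivative within `s` is not unique in transverse directions.
  exact (h2.hasDerivAt hs).unique h

theorem mfderiv_eq_of_hasDerivAt {E' M' : Type*} [NormedAddCommGroup E'] [NormedSpace ℝ E']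
    [TopologicalSpace M'] [ChartedSpace E' M'] {e' : OpenPartialHomeomorph M' E'}
    (he : ∀ x : M, chartAt E x = e) (he' : ∀ x : M', chartAt E' x = e')
    {f : M → M'} {x : M} (hf : MDifferentiableAt 𝓘(ℝ, E) 𝓘(ℝ, E') f x)
    {v : E} {w : E'}
    (h : HasDerivAt (fun t : ℝ => e' (f (e.symm (e x + t • v)))) w 0) :
    (mfderiv 𝓘(ℝ, E) 𝓘(ℝ, E') f x : E →L[ℝ] E') v = w := by
  rw [← mfderivWithin_univ]
  exact mfderivWithin_eq_of_hasDerivAt he he' hf.mdifferentiableWithinAt (by simp) h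

variable [IsManifold 𝓘(ℝ, E) ∞ M]

/-- The tangent bundle is trivialised by the one chart, so its coordinate changes are the identity
and the fibre component can be tested as a map to `E`. -/
theorem contMDiffAt_tangentBundle_of_chartAt_eq {E' M' : Type*} [NormedAddCommGroup E']
    [NormedSpace ℝ E'] {H' : Type*} [TopologicalSpace H'] {J : ModelWithCorners ℝ E' H'}
    [TopologicalSpace M'] [ChartedSpace H' M'] (he : ∀ x : M, chartAt E x = e)
    {f : M' → M} {v : M' → E} {z : M'} (hf : ContMDiffAt J 𝓘(ℝ, E) ∞ f z)
    (hv : ContMDiffAt J 𝓘(ℝ, E) ∞ v z) :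
    ContMDiffAt J 𝓘(ℝ, E).tangent ∞
      (fun p => (⟨f p, (v p : E)⟩ : TangentBundle 𝓘(ℝ, E) M)) z := by
  rw [Bundle.contMDiffAt_totalSpace]
  refine ⟨hf, hv.congr_of_eventuallyEq (Eventually.of_forall fun p => ?_)⟩
  have h : achart E (f p) = achart E (f z) := Subtype.ext ((he _).trans (he _).symm)
  change (tangentBundleCore 𝓘(ℝ, E) M).coordChange (achart E (f p)) (achart E (f z)) (f p) (v p)
    = v p
  rw [← h]
  exact tangentCoordChange_self (I := 𝓘(ℝ, E)) (by simp)

theorem mfderiv_extChartAt_of_chartAt_eq (he : ∀ x : M, chartAt E x = e) (x : M) :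
    (mfderiv 𝓘(ℝ, E) 𝓘(ℝ, E) (extChartAt 𝓘(ℝ, E) x) x : E →L[ℝ] E) =
      ContinuousLinearMap.id ℝ E := by
  refine ContinuousLinearMap.ext fun v : E => ?_
  have hx : x ∈ e.source := by rw [← he x]; exact mem_chart_source E x
  refine mfderiv_eq_of_hasDerivAt he (fun _ => chartAt_self_eq)
    (mdifferentiableAt_extChartAt (mem_chart_source E x)) ?_
  have hγ : HasDerivAt (fun t : ℝ => e x + t • v) v 0 := by
    simpa using ((hasDerivAt_id (0 : ℝ)).smul_const v).const_add (e x)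
  refine hγ.congr_of_eventuallyEq ?_
  have h1 : ∀ᶠ t : ℝ in 𝓝 0, e x + t • v ∈ e.target :=
    hγ.continuousAt.eventually_mem (e.open_target.mem_nhds (by simpa using e.map_source hx))
  filter_upwards [h1] with t ht
  simp [he, e.right_inv ht]

theorem mfderivWithin_extChartAt_symm_of_chartAt_eq (he : ∀ x : M, chartAt E x = e) (x : M)
    {p : E} (hp : p ∈ e.target) :
    (mfderivWithin 𝓘(ℝ, E) 𝓘(ℝ, E) (extChartAt 𝓘(ℝ, E) x).symm (range 𝓘(ℝ, E)) p : E →L[ℝ] E) =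
      ContinuousLinearMap.id ℝ E := by
  refine ContinuousLinearMap.ext fun v : E => ?_
  refine mfderivWithin_eq_of_hasDerivAt (fun _ => chartAt_self_eq) he ?_ (by simp) ?_
  · refine mdifferentiableWithinAt_extChartAt_symm ?_
    rw [extChartAt_eq_of_chartAt_eq he]
    exact hp
  have hγ : HasDerivAt (fun t : ℝ => p + t • v) v 0 := by
    simpa using ((hasDerivAt_id (0 : ℝ)).smul_const v).const_add p
  refine hγ.congr_of_eventuallyEq ?_
  have h1 : ∀ᶠ t : ℝ in 𝓝 0, p + t • v ∈ e.target :=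
    hγ.continuousAt.eventually_mem (e.open_target.mem_nhds (by simpa using hp))
  filter_upwards [h1] with t ht
  simp [he, e.right_inv ht]

theorem inverse_apply_of_eq_id {A : E →L[ℝ] E} (hA : A = ContinuousLinearMap.id ℝ E) (v : E) :
    A.inverse v = v := by
  rw [hA, ContinuousLinearMap.inverse_id, ContinuousLinearMap.id_apply]

/-- The bracket on `M` is obtained by pulling back along the inverse chart, taking the bracket in
`E`, and pulling back along the chart. Both differentials are the identity here, so only the
coordinate expressions near `e x` matter. -/
theorem mlieBracket_eq_lieBracket (he : ∀ x : M, chartAt E x = e)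
    (V W : E → E) (x : M) (V' W' : ∀ x : M, TangentSpace 𝓘(ℝ, E) x)
    (hV : ∀ x, (V' x : E) = V (e x)) (hW : ∀ x, (W' x : E) = W (e x)) :
    (VectorField.mlieBracket 𝓘(ℝ, E) V' W' x : E) = VectorField.lieBracket ℝ V W (e x) := by
  have hx : x ∈ e.source := by rw [← he x]; exact mem_chart_source E x
  have key : ∀ (Z : E → E) (Z' : ∀ x : M, TangentSpace 𝓘(ℝ, E) x), (∀ x, (Z' x : E) = Z (e x)) →
      (VectorField.mpullbackWithin 𝓘(ℝ, E) 𝓘(ℝ, E) (extChartAt 𝓘(ℝ, E) x).symm Z'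
        (range 𝓘(ℝ, E)) : E → E) =ᶠ[𝓝 (e x)] Z := fun Z Z' hZ => by
    filter_upwards [e.open_target.mem_nhds (e.map_source hx)] with p hp
    refine (inverse_apply_of_eq_id (E := E)
      (mfderivWithin_extChartAt_symm_of_chartAt_eq he x hp) _).trans ?_
    have h4 : e ((extChartAt 𝓘(ℝ, E) x).symm p) = p := by simp [he, e.right_inv hp]
    exact (hZ _).trans (congrArg Z h4)
  refine (inverse_apply_of_eq_id (E := E) (mfderiv_extChartAt_of_chartAt_eq he x) _).trans ?_
  have h2 : extChartAt 𝓘(ℝ, E) x x = e x := by simp [he]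
  have h3 : (extChartAt 𝓘(ℝ, E) x).symm ⁻¹' univ ∩ range 𝓘(ℝ, E) = univ := by simp
  refine (congrArg₂ (VectorField.lieBracketWithin (E := E) ℝ _ _) h3 h2).trans ?_
  refine (congrFun (VectorField.lieBracketWithin_univ (E := E)) _).trans ?_
  exact (key V V' hV).lieBracket_vectorField_eq (key W W' hW)

end SingleChart

/-! ### Argument, logarithm and the polar form of the diagonal entry -/

section Coordinates

open Complex Set Filter Topology

/-- The sector of nonzero complex numbers with argument in `(-π/3, π/3)`. -/
def argSector : Set ℂ := {z | z ≠ 0 ∧ -(Real.pi / 3) < z.arg ∧ z.arg < Real.pi / 3}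

theorem argSector_subset_slitPlane : argSector ⊆ slitPlane := fun z hz =>
  mem_slitPlane_iff_arg.2 ⟨by linarith [hz.2.2, Real.pi_pos], hz.1⟩

theorem isOpen_argSector : IsOpen argSector := by
  have h : argSector = slitPlane ∩ arg ⁻¹' Ioo (-(Real.pi / 3)) (Real.pi / 3) := by
    ext z
    exact ⟨fun hz => ⟨argSector_subset_slitPlane hz, hz.2⟩,
      fun hz => ⟨slitPlane_ne_zero hz.1, hz.2⟩⟩
  rw [h]
  exact ContinuousOn.isOpen_inter_preimage
    (fun z hz => (continuousAt_arg hz).continuousWithinAt) isOpen_slitPlane isOpen_Ioo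

/-- This is what the bound π/3 is for. The two sides agree modulo 2π, and arg c - arg a - arg a' is
a combination of three angles below π/3 in absolute value, so it lies in (-π, π) and is a principal
value. -/
theorem div_mem_slitPlane_of_mem_argSector {a a' c : ℂ} (ha : a ∈ argSector) (ha' : a' ∈ argSector)
    (hc : c ∈ argSector) :
    c / (a * a') ∈ slitPlane ∧ arg c = arg a + arg a' + arg (c / (a * a')) := by
  obtain ⟨h0, h1, h2⟩ := ha
  obtain ⟨h0', h1', h2'⟩ := ha'
  obtain ⟨k0, k1, k2⟩ := hc
  have key : arg (c / (a * a')) = arg c - (arg a + arg a') := by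
    have h := arg_div_coe_angle k0 (mul_ne_zero h0 h0')
    rw [arg_mul_coe_angle h0 h0', ← Real.Angle.coe_add, ← Real.Angle.coe_sub] at h
    have h3 := congrArg Real.Angle.toReal h
    rwa [arg_coe_angle_toReal_eq_arg, Real.Angle.toReal_coe_eq_self_iff.2] at h3
    constructor <;> linarith
  refine ⟨mem_slitPlane_iff_arg.2 ⟨?_, div_ne_zero k0 (mul_ne_zero h0 h0')⟩, ?_⟩
  · rw [key]; linarith
  · rw [key]; ring

/-- The function `Im (log (1 + y w) / y)`, extended smoothly to `y = 0`. -/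
noncomputable def imLogQuot (y : ℝ) (w : ℂ) : ℝ := (w * dslope Complex.log 1 (1 + y * w)).im

theorem imLogQuot_zero (w : ℂ) : imLogQuot 0 w = w.im := by
  have h : deriv Complex.log 1 = 1 := by
    simpa using (hasDerivAt_log one_mem_slitPlane).deriv
  simp [imLogQuot, h]

/-- In this multiplied form the case y = 0 needs no separate treatment. -/
theorem mul_imLogQuot (y : ℝ) (w : ℂ) : y * imLogQuot y w = arg (1 + y * w) := by
  have h := sub_smul_dslope Complex.log 1 (1 + y * w)
  rw [log_one, sub_zero, add_sub_cancel_left, smul_eq_mul] at h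
  rw [imLogQuot, ← im_ofReal_mul, ← mul_assoc, h, log_im]

theorem imLogQuot_of_ne_zero {y : ℝ} (hy : y ≠ 0) (w : ℂ) :
    imLogQuot y w = (1 / y) * arg (1 + y * w) := by
  rw [← mul_imLogQuot]; field_simp

theorem imLogQuot_zero_right (y : ℝ) : imLogQuot y 0 = 0 := by simp [imLogQuot]

/-- Removable singularity: the difference quotient of a holomorphic function, completed by the
derivative, is holomorphic and therefore smooth. -/
theorem contDiffOn_dslope_log : ContDiffOn ℝ ∞ (dslope Complex.log 1) slitPlane := by
  have h : DifferentiableOn ℂ (dslope Complex.log 1) slitPlane :=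
    (differentiableOn_dslope (isOpen_slitPlane.mem_nhds (by simp))).2
      (fun z hz => (differentiableAt_log hz).differentiableWithinAt)
  exact (h.contDiffOn isOpen_slitPlane (n := ∞)).restrict_scalars ℝ

theorem contDiffAt_imLogQuot {y : ℝ} {w : ℂ} (h : 1 + y * w ∈ slitPlane) :
    ContDiffAt ℝ ∞ (fun p : ℝ × ℂ => imLogQuot p.1 p.2) (y, w) := by
  have h1 : ContDiffAt ℝ ∞ (fun p : ℝ × ℂ => 1 + (p.1 : ℂ) * p.2) (y, w) := by
    have : ContDiff ℝ ∞ (fun p : ℝ × ℂ => (p.1 : ℂ)) := ofRealCLM.contDiff.comp contDiff_fst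
    fun_prop
  have h2 : ContDiffAt ℝ ∞ (dslope Complex.log 1) (1 + (y : ℂ) * w) :=
    contDiffOn_dslope_log.contDiffAt (isOpen_slitPlane.mem_nhds h)
  exact imCLM.contDiff.contDiffAt.comp (y, w)
    (contDiff_snd.contDiffAt.mul (h2.comp (y, w) h1))

/-- The entry `a` of the element of `G_y` with `arg a = θ` and off-diagonal entry `b`. -/
noncomputable def diagEntry (y θ : ℝ) (b : ℂ) : ℂ := (√(1 - y * normSq b) : ℝ) * exp (θ * I)

theorem conj_diagEntry (y θ : ℝ) (b : ℂ) : conj (diagEntry y θ b) = diagEntry y (-θ) (-b) := by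
  simp [diagEntry, ← exp_conj]

theorem diagEntry_mul_conj {y : ℝ} (θ : ℝ) {b : ℂ} (h : y * normSq b < 1) :
    diagEntry y θ b * conj (diagEntry y θ b) = 1 - y * (b * conj b) := by
  have h1 : (√(1 - y * normSq b)) * (√(1 - y * normSq b)) = 1 - y * normSq b :=
    Real.mul_self_sqrt (by linarith)
  rw [conj_diagEntry, diagEntry, diagEntry, mul_mul_mul_comm, normSq_neg, ← ofReal_mul, h1,
    ← exp_add, mul_conj]
  push_cast
  simp

theorem diagEntry_mem_argSector {y θ : ℝ} {b : ℂ} (h : y * normSq b < 1)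
    (h1 : -(Real.pi / 3) < θ) (h2 : θ < Real.pi / 3) :
    diagEntry y θ b ∈ argSector ∧ arg (diagEntry y θ b) = θ := by
  have h0 : 0 < √(1 - y * normSq b) := Real.sqrt_pos.2 (by linarith)
  have h3 : arg (diagEntry y θ b) = θ :=
    (arg_real_mul _ h0).trans ((arg_exp_mul_I θ).trans
      (toIocMod_eq_self _ |>.2 ⟨by linarith, by linarith⟩))
  exact ⟨⟨mul_ne_zero (ofReal_ne_zero.2 h0.ne') (exp_ne_zero _), by rwa [h3], by rwa [h3]⟩, h3⟩

theorem diagEntry_eq {y : ℝ} {a b : ℂ} (h : a * conj a + y * (b * conj b) = 1) :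
    diagEntry y (arg a) b = a := by
  have h1 : ‖a‖ ^ 2 = 1 - y * normSq b := by
    rw [mul_conj, mul_conj] at h
    rw [← normSq_eq_norm_sq, eq_sub_iff_add_eq]
    exact_mod_cast h
  rw [diagEntry, ← h1, Real.sqrt_sq (norm_nonneg a), norm_mul_exp_arg_mul_I]

theorem contDiff_normSq {n : ℕ∞ω} : ContDiff ℝ n (fun b : ℂ => normSq b) := by
  simp only [normSq_apply]
  exact (reCLM.contDiff.mul reCLM.contDiff).add (imCLM.contDiff.mul imCLM.contDiff)

theorem contDiffAt_diagEntry {y θ : ℝ} {b : ℂ} (h : y * normSq b < 1) :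
    ContDiffAt ℝ ∞ (fun p : ℝ × ℝ × ℂ => diagEntry p.1 p.2.1 p.2.2) (y, θ, b) := by
  have h1 : ContDiff ℝ ∞ (fun p : ℝ × ℝ × ℂ => 1 - p.1 * normSq p.2.2) := by
    have := contDiff_normSq (n := ∞)
    fun_prop
  have h2 : ContDiffAt ℝ ∞ (fun p : ℝ × ℝ × ℂ => √(1 - p.1 * normSq p.2.2)) (y, θ, b) :=
    h1.contDiffAt.sqrt (by simpa using by linarith)
  have h3 : ContDiff ℝ ∞ (fun p : ℝ × ℝ × ℂ => exp ((p.2.1 : ℂ) * I)) := by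
    have : ContDiff ℝ ∞ (fun p : ℝ × ℝ × ℂ => (p.2.1 : ℂ)) :=
      ofRealCLM.contDiff.comp (contDiff_fst.comp contDiff_snd)
    fun_prop
  exact (ofRealCLM.contDiff.contDiffAt.comp (y, θ, b) h2).mul h3.contDiffAt

/-- Logarithmic differentiation: log a = ½ log(1 - y|b|²) + iθ has derivative iτ - y Re(conj(b) β) /
(1 - y|b|²). -/
theorem hasDerivAt_diagEntry {y : ℝ} (θ τ : ℝ) {b : ℂ} (β : ℂ) (h : y * normSq b < 1) :
    HasDerivAt (fun t : ℝ => diagEntry y (θ + t * τ) (b + t * β))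
      (diagEntry y θ b * (τ * I - (y * (conj b * β).re / (1 - y * normSq b) : ℝ))) 0 := by
  have hN : HasDerivAt (fun t : ℝ => 1 - y * normSq (b + t * β)) (-(y * (2 * (conj b * β).re))) 0 := by
    have h1 : (fun t : ℝ => 1 - y * normSq (b + t * β)) =
        fun t : ℝ => 1 - y * (normSq b + t * (2 * (conj b * β).re) + t ^ 2 * normSq β) := by
      funext t
      congr 2
      simp [normSq_apply]
      ring
    rw [h1]
    have h2 := (((hasDerivAt_id (0 : ℝ)).mul_const (2 * (conj b * β).re)).const_add (normSq b)).add
      ((hasDerivAt_pow 2 (0 : ℝ)).mul_const (normSq β))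
    simpa using (h2.const_mul y).const_sub 1
  have h0 : 0 < 1 - y * normSq b := by linarith
  have hs := (hN.sqrt (by simpa using h0.ne')).ofReal_comp
  have hl : HasDerivAt (fun t : ℝ => θ + t * τ) τ 0 := by
    simpa using ((hasDerivAt_id (0 : ℝ)).mul_const τ).const_add θ
  have he := (hl.ofReal_comp.mul_const I).cexp
  refine (hs.mul he).congr_deriv ?_
  have h3 : (√(1 - y * normSq b) : ℂ) * √(1 - y * normSq b) = (1 - y * normSq b : ℝ) := by
    rw [← ofReal_mul, Real.mul_self_sqrt h0.le]
  have h4 : (√(1 - y * normSq b) : ℂ) ≠ 0 := ofReal_ne_zero.2 (Real.sqrt_pos.2 h0).ne'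
  have h5 : ((1 - y * normSq b : ℝ) : ℂ) ≠ 0 := ofReal_ne_zero.2 h0.ne'
  simp only [diagEntry, zero_mul, add_zero, ofReal_zero]
  rw [ofReal_div, ofReal_div, ← h3]
  push_cast
  field_simp
  ring

end Coordinates

/-! ### Multiplication and left invariant fields in coordinates -/

section CoordinateFormulas

open Complex Set Filter Topology

/-- Coordinates `(y, r, θ, b)` for the point of `A_ℝ` over `y` with first component `r`,
off-diagonal entry `b` and diagonal entry of argument `θ`. -/
abbrev BundleCoord := ℝ × ℝ × ℝ × ℂ

namespace BundleCoord

/-- The coordinates of the points of `A_ℝ`. -/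
def domain : Set BundleCoord :=
  {p | p.1 * normSq p.2.2.2 < 1 ∧ -(Real.pi / 3) < p.2.2.1 ∧ p.2.2.1 < Real.pi / 3}

theorem isOpen_domain : IsOpen domain := by
  have h : Continuous fun p : BundleCoord => p.1 * normSq p.2.2.2 := by
    have := continuous_normSq
    fun_prop
  have hθ : Continuous fun p : BundleCoord => p.2.2.1 := by fun_prop
  exact (isOpen_lt h continuous_const).inter ((isOpen_lt continuous_const hθ).inter
    (isOpen_lt hθ continuous_const))

/-- The diagonal entry of the point with the given coordinates. -/
noncomputable def diag (p : BundleCoord) : ℂ := diagEntry p.1 p.2.2.1 p.2.2.2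

theorem diag_ne_zero {p : BundleCoord} (hp : p ∈ domain) : diag p ≠ 0 :=
  (diagEntry_mem_argSector hp.1 hp.2.1 hp.2.2).1.1

theorem diag_mul_conj {p : BundleCoord} (hp : p ∈ domain) :
    diag p * conj (diag p) = 1 - p.1 * (p.2.2.2 * conj p.2.2.2) :=
  diagEntry_mul_conj _ hp.1

theorem contDiffAt_diag {p : BundleCoord} (hp : p ∈ domain) : ContDiffAt ℝ ∞ diag p :=
  (contDiffAt_diagEntry hp.1).comp p
    (f := fun p : BundleCoord => (p.1, p.2.2.1, p.2.2.2)) (by fun_prop)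

/-- The quantity `w` such that `Ω_y(g, h) = Im (log (1 + y w) / y)`. -/
noncomputable def cocycleArg (p q : BundleCoord) : ℂ :=
  -(p.2.2.2 * conj q.2.2.2) / (diag p * diag q)

/-- The multiplication of `A_ℝ` in coordinates. -/
noncomputable def mul (p q : BundleCoord) : BundleCoord :=
  (p.1, p.2.1 + q.2.1 + imLogQuot p.1 (cocycleArg p q),
    p.2.2.1 + q.2.2.1 + p.1 * imLogQuot p.1 (cocycleArg p q),
    diag p * q.2.2.2 + p.2.2.2 * conj (diag q))

theorem contDiffAt_mul {p q : BundleCoord} (hp : p ∈ domain) (hq : q ∈ domain)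
    (h : 1 + p.1 * cocycleArg p q ∈ slitPlane) :
    ContDiffAt ℝ ∞ (fun x : BundleCoord × BundleCoord => mul x.1 x.2) (p, q) := by
  have h1 : ContDiffAt ℝ ∞ (fun x : BundleCoord × BundleCoord => diag x.1) (p, q) :=
    (contDiffAt_diag hp).comp (p, q) contDiffAt_fst
  have h2 : ContDiffAt ℝ ∞ (fun x : BundleCoord × BundleCoord => diag x.2) (p, q) :=
    (contDiffAt_diag hq).comp (p, q) contDiffAt_snd
  have hc : ContDiff ℝ ∞ (fun z : ℂ => conj z) := conjCLE.contDiff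
  have h3 : ContDiffAt ℝ ∞ (fun x : BundleCoord × BundleCoord => cocycleArg x.1 x.2) (p, q) := by
    have h := (h1.mul h2).inv (mul_ne_zero (diag_ne_zero hp) (diag_ne_zero hq))
    simp only [cocycleArg, div_eq_mul_inv]
    exact ContDiffAt.mul (by fun_prop) h
  have h4 : ContDiffAt ℝ ∞
      (fun x : BundleCoord × BundleCoord => imLogQuot x.1.1 (cocycleArg x.1 x.2)) (p, q) :=
    (contDiffAt_imLogQuot h).comp (p, q)
      (f := fun x : BundleCoord × BundleCoord => (x.1.1, cocycleArg x.1 x.2))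
      ((contDiff_fst.comp contDiff_fst).contDiffAt.prodMk h3)
  unfold mul
  fun_prop

/-- The linear combination of the tangent vectors `J₀, J₁, J₂, J₃` at a unit, in coordinates. -/
noncomputable def unitVec : (Fin 4 → ℝ) →ₗ[ℝ] BundleCoord where
  toFun u := (0, u 0, u 1, u 2 + u 3 * I)
  map_add' u v := by ext <;> simp; ring
  map_smul' c u := by ext <;> simp; ring

theorem unitVec_apply (u : Fin 4 → ℝ) : unitVec u = (0, u 0, u 1, u 2 + u 3 * I) := rfl

theorem unitVec_injective : Function.Injective unitVec := by
  intro u v h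
  simp only [unitVec_apply, Prod.mk.injEq, Complex.ext_iff] at h
  ext i
  fin_cases i <;> simp_all

theorem exists_unitVec_eq {p : BundleCoord} (hp : p.1 = 0) : ∃ u, unitVec u = p :=
  ⟨![p.2.1, p.2.2.1, p.2.2.2.re, p.2.2.2.im], by ext <;> simp [unitVec_apply, hp]⟩

/-- The value at the point with coordinates `p` of the left invariant vector field on the fibre
of `A_ℝ` with value `unitVec u` at the unit. -/
noncomputable def leftVec (p : BundleCoord) (u : Fin 4 → ℝ) : BundleCoord :=
  (0, u 0 - (p.2.2.2 * conj (u 2 + u 3 * I : ℂ) / diag p).im,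
    u 1 - p.1 * (p.2.2.2 * conj (u 2 + u 3 * I : ℂ) / diag p).im,
    diag p * (u 2 + u 3 * I) - u 1 * I * p.2.2.2)

/-- Since log'(1) = 1, `imLogQuot y w` agrees with Im w to first order at w = 0, for every y
including 0. -/
theorem _root_.hasDerivAt_imLogQuot (y : ℝ) {w : ℝ → ℂ} {w' : ℂ} (h0 : w 0 = 0)
    (hw : HasDerivAt w w' 0) : HasDerivAt (fun t => imLogQuot y (w t)) w'.im 0 := by
  have h1 : DifferentiableAt ℝ (dslope Complex.log 1) (1 + y * w 0) :=
    (contDiffOn_dslope_log.contDiffAt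
      (isOpen_slitPlane.mem_nhds (by simp [h0]))).differentiableAt (by simp)
  have h2 : DifferentiableAt ℝ (fun t => dslope Complex.log 1 (1 + y * w t)) 0 :=
    h1.comp (0 : ℝ) ((hw.differentiableAt.const_mul (y : ℂ)).const_add 1)
  have h3 := (hw.mul h2.hasDerivAt)
  have h4 : deriv Complex.log 1 = 1 := by
    simpa using (hasDerivAt_log one_mem_slitPlane).deriv
  have h5 := imCLM.hasFDerivAt.comp_hasDerivAt (0 : ℝ) h3
  exact h5.congr_deriv (by simp [h0, h4])

/-- The curve runs inside the fibre through the unit. To first order its diagonal entry is 1 + i t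
u₁ and its off-diagonal entry is t c with c = u₂ + i u₃, so the argument of `imLogQuot` is -t b
conj(c) / a. -/
theorem hasDerivAt_mul {p : BundleCoord} (hp : p ∈ domain) (u : Fin 4 → ℝ) :
    HasDerivAt (fun t : ℝ => mul p ((p.1, 0, 0, 0) + t • unitVec u)) (leftVec p u) 0 := by
  have ha := diag_ne_zero hp
  have hc : HasDerivAt (fun t : ℝ => (t : ℂ) * (u 2 + u 3 * I)) (u 2 + u 3 * I) 0 := by
    simpa using (hasDerivAt_id (0 : ℝ)).ofReal_comp.mul_const (u 2 + u 3 * I : ℂ)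
  have hl : ∀ c : ℝ, HasDerivAt (fun t : ℝ => t * c) c 0 := fun c => by
    simpa using (hasDerivAt_id (0 : ℝ)).mul_const c
  -- At b = 0 the modulus √(1 - y|b|²) is stationary, so only the angle contributes.
  have hq : HasDerivAt (fun t : ℝ => diagEntry p.1 (t * u 1) (t * (u 2 + u 3 * I))) (u 1 * I) 0 := by
    have h := hasDerivAt_diagEntry (y := p.1) 0 (u 1) (b := 0) (u 2 + u 3 * I) (by simp)
    simpa [diagEntry] using h
  have hq0 : diagEntry p.1 0 0 = 1 := by simp [diagEntry]
  have hconj : ∀ {f : ℝ → ℂ} {f' : ℂ}, HasDerivAt f f' 0 →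
      HasDerivAt (fun t => conj (f t)) (conj f') 0 := fun h =>
    conjCLE.toContinuousLinearMap.hasFDerivAt.comp_hasDerivAt (0 : ℝ) h
  have hw : HasDerivAt (fun t : ℝ => -(p.2.2.2 * conj ((t : ℂ) * (u 2 + u 3 * I))) /
      (diag p * diagEntry p.1 (t * u 1) (t * (u 2 + u 3 * I))))
      (-(p.2.2.2 * conj (u 2 + u 3 * I : ℂ) / diag p)) 0 := by
    have h := ((hconj hc).const_mul p.2.2.2).neg.div (hq.const_mul (diag p))
      (by simpa [hq0] using ha)
    refine h.congr_deriv ?_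
    simp only [ofReal_zero, zero_mul, hq0, map_zero, Pi.neg_apply, mul_zero, neg_zero]
    field_simp
    ring
  have hΩ := hasDerivAt_imLogQuot p.1 (by simp) hw
  have h1 : (fun t : ℝ => mul p ((p.1, 0, 0, 0) + t • unitVec u)) = fun t : ℝ =>
      (p.1, p.2.1 + t * u 0 + imLogQuot p.1 (-(p.2.2.2 * conj ((t : ℂ) * (u 2 + u 3 * I))) /
        (diag p * diagEntry p.1 (t * u 1) (t * (u 2 + u 3 * I)))),
      p.2.2.1 + t * u 1 + p.1 * imLogQuot p.1 (-(p.2.2.2 * conj ((t : ℂ) * (u 2 + u 3 * I))) /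
        (diag p * diagEntry p.1 (t * u 1) (t * (u 2 + u 3 * I)))),
      diag p * ((t : ℂ) * (u 2 + u 3 * I)) +
        p.2.2.2 * conj (diagEntry p.1 (t * u 1) (t * (u 2 + u 3 * I)))) := by
    funext t
    simp [mul, cocycleArg, unitVec_apply, diag, mul_add]
  rw [h1]
  refine ((hasDerivAt_const (0 : ℝ) p.1).prodMk ((((hl (u 0)).const_add p.2.1).add hΩ).prodMk
    ((((hl (u 1)).const_add p.2.2.1).add (hΩ.const_mul p.1)).prodMk
      ((hc.const_mul (diag p)).add ((hconj hq).const_mul p.2.2.2))))).congr_deriv ?_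
  simp only [leftVec, Prod.mk.injEq, neg_im, true_and]
  refine ⟨by ring, by ring, ?_⟩
  simp
  ring

/-- With X = (i u₁, c; -y conj(c), -i u₁) and c = u₂ + i u₃, the derivative of the matrix g along
the field must be g X. The value found here is its upper left entry; the last component of `leftVec`
is its upper right entry. -/
theorem hasDerivAt_diag_leftVec {p : BundleCoord} (hp : p ∈ domain) (u : Fin 4 → ℝ) :
    HasDerivAt (fun t : ℝ => diag (p + t • leftVec p u))
      (u 1 * I * diag p - p.1 * p.2.2.2 * conj (u 2 + u 3 * I : ℂ)) 0 := by
  have ha := diag_ne_zero hp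
  have h := hasDerivAt_diagEntry p.2.2.1 (leftVec p u).2.2.1 (leftVec p u).2.2.2 hp.1
  have h1 : (fun t : ℝ => diag (p + t • leftVec p u)) = fun t : ℝ =>
      diagEntry p.1 (p.2.2.1 + t * (leftVec p u).2.2.1)
        (p.2.2.2 + t * (leftVec p u).2.2.2) := by
    funext t
    simp [diag, leftVec]
  rw [h1]
  refine h.congr_deriv ?_
  have hN : diag p * conj (diag p) = (1 - p.1 * normSq p.2.2.2 : ℝ) := by
    rw [diag_mul_conj hp, mul_conj]; push_cast; rfl
  have hN0 : (1 - p.1 * normSq p.2.2.2) ≠ 0 := by linarith [hp.1]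
  -- In conj(b)(a c - i u₁ b) the second term is purely imaginary and the first has the real part of
  -- its conjugate b conj(c) conj(a). Dividing by |a|² = 1 - y|b|² gives Re(b conj(c) / a).
  have hre : (conj p.2.2.2 * (leftVec p u).2.2.2).re / (1 - p.1 * normSq p.2.2.2) =
      (p.2.2.2 * conj (u 2 + u 3 * I : ℂ) / diag p).re := by
    have h2 : p.2.2.2 * conj (u 2 + u 3 * I : ℂ) / diag p =
        p.2.2.2 * conj (u 2 + u 3 * I : ℂ) * conj (diag p) / (1 - p.1 * normSq p.2.2.2 : ℝ) := by
      rw [← hN]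
      have := (map_ne_zero (starRingEnd ℂ)).2 ha
      field_simp
    rw [h2, div_ofReal_re]
    congr 1
    simp [leftVec]
    ring
  rw [mul_div_assoc, hre, ← diag]
  -- For z = b conj(c) / a, the modulus contributes -y Re z and the angle -y i Im z to a'/a;
  -- together they are -y z.
  obtain ⟨z, hz⟩ : ∃ z, z = p.2.2.2 * conj (u 2 + u 3 * I : ℂ) / diag p := ⟨_, rfl⟩
  have h3 : p.2.2.2 * conj (u 2 + u 3 * I : ℂ) = diag p * z := by rw [hz]; field_simp
  have h4 : (leftVec p u).2.2.1 = u 1 - p.1 * z.im := by rw [hz]; rfl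
  rw [h4, ← hz, mul_assoc (p.1 : ℂ), h3]
  conv_rhs => rw [← re_add_im z]
  push_cast
  ring

/-- The derivative of a left invariant vector field in the direction of another one. -/
noncomputable def leftVecDeriv (p : BundleCoord) (u v : Fin 4 → ℝ) : BundleCoord :=
  let c : ℂ := u 2 + u 3 * I
  let d : ℂ := v 2 + v 3 * I
  let W : ℂ := (c - 2 * (u 1 * I) * (p.2.2.2 / diag p) +
    p.1 * (p.2.2.2 / diag p) ^ 2 * conj c) * conj d
  (0, -W.im, -(p.1 * W.im), (u 1 * I * diag p - p.1 * p.2.2.2 * conj c) * d -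
    v 1 * I * (diag p * c - u 1 * I * p.2.2.2))

theorem hasDerivAt_leftVec {p : BundleCoord} (hp : p ∈ domain) (u v : Fin 4 → ℝ) :
    HasDerivAt (fun t : ℝ => leftVec (p + t • leftVec p u) v) (leftVecDeriv p u v) 0 := by
  have ha := diag_ne_zero hp
  have hd := hasDerivAt_diag_leftVec hp u
  have hb : HasDerivAt (fun t : ℝ => p.2.2.2 + (t : ℂ) * (leftVec p u).2.2.2)
      (leftVec p u).2.2.2 0 := by
    simpa using ((hasDerivAt_id (0 : ℝ)).ofReal_comp.mul_const (leftVec p u).2.2.2).const_add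
      p.2.2.2
  have hW := (hb.mul_const (conj (v 2 + v 3 * I : ℂ))).div hd (by simpa using ha)
  have hWi := imCLM.hasFDerivAt.comp_hasDerivAt (0 : ℝ) hW
  have h1 : (fun t : ℝ => leftVec (p + t • leftVec p u) v) = fun t : ℝ =>
      (0, v 0 - ((p.2.2.2 + (t : ℂ) * (leftVec p u).2.2.2) * conj (v 2 + v 3 * I : ℂ) /
          diag (p + t • leftVec p u)).im,
        v 1 - p.1 * ((p.2.2.2 + (t : ℂ) * (leftVec p u).2.2.2) * conj (v 2 + v 3 * I : ℂ) /
          diag (p + t • leftVec p u)).im,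
        diag (p + t • leftVec p u) * (v 2 + v 3 * I) -
          v 1 * I * (p.2.2.2 + (t : ℂ) * (leftVec p u).2.2.2)) := by
    funext t
    have h2 : (leftVec p u).1 = 0 := rfl
    conv_lhs => rw [leftVec]
    simp [h2]
  rw [h1]
  refine ((hasDerivAt_const (0 : ℝ) (0 : ℝ)).prodMk ((hWi.const_sub (v 0)).prodMk
    (((hWi.const_mul p.1).const_sub (v 1)).prodMk
      ((hd.mul_const _).sub (hb.const_mul _))))).congr_deriv ?_
  simp only [leftVecDeriv, imCLM_apply, zero_smul, add_zero, ofReal_zero, zero_mul]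
  -- Quotient rule: (b/a)' = c - 2 i u₁ (b/a) + y (b/a)² conj(c).
  have h3 : ((leftVec p u).2.2.2 * conj (v 2 + v 3 * I : ℂ) * diag p -
      p.2.2.2 * conj (v 2 + v 3 * I : ℂ) * (u 1 * I * diag p -
        p.1 * p.2.2.2 * conj (u 2 + u 3 * I : ℂ))) / diag p ^ 2 =
      (u 2 + u 3 * I - 2 * (u 1 * I) * (p.2.2.2 / diag p) +
        p.1 * (p.2.2.2 / diag p) ^ 2 * conj (u 2 + u 3 * I : ℂ)) * conj (v 2 + v 3 * I : ℂ) := by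
    simp only [leftVec]
    field_simp
    ring
  rw [h3]
  rfl

/-- This is the structure equation of the Lie algebra. It is polynomial once b/a is treated as an
independent variable z: no relation between a, b and z is needed. -/
theorem leftVecDeriv_sub (p : BundleCoord) (u v : Fin 4 → ℝ) :
    leftVecDeriv p u v - leftVecDeriv p v u = leftVec p (suExtBracket p.1 u v) := by
  simp only [leftVecDeriv, leftVec, suExtBracket, mul_div_right_comm]
  generalize p.2.2.2 / diag p = z
  ext
  · simp
  · simp
    ring
  · simp
    ring
  · simp
    linear_combination (2 * diag p * (u 1 * v 3 - u 3 * v 1)) * I_sq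

theorem contDiffOn_leftVec {u : ℝ → Fin 4 → ℝ} (hu : ContDiff ℝ ∞ u) :
    ContDiffOn ℝ ∞ (fun p : BundleCoord => leftVec p (u p.1)) domain := by
  intro p hp
  refine ContDiffAt.contDiffWithinAt ?_
  have h0 := contDiff_pi.1 hu
  have h1 : ∀ i, ContDiff ℝ ∞ (fun p : BundleCoord => u p.1 i) := fun i => (h0 i).comp contDiff_fst
  have h2 : ∀ i, ContDiff ℝ ∞ (fun p : BundleCoord => (u p.1 i : ℂ)) := fun i =>
    ofRealCLM.contDiff.comp (h1 i)
  have hd := contDiffAt_diag hp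
  have hc : ContDiff ℝ ∞ (fun z : ℂ => conj z) := conjCLE.contDiff
  have hi : ContDiff ℝ ∞ (fun z : ℂ => z.im) := imCLM.contDiff
  have hW : ContDiffAt ℝ ∞ (fun p : BundleCoord =>
      p.2.2.2 * conj (u p.1 2 + u p.1 3 * I : ℂ) / diag p) p := by
    have h := hd.inv (diag_ne_zero hp)
    simp only [div_eq_mul_inv]
    exact ContDiffAt.mul (by fun_prop) h
  have hWi := hi.contDiffAt.comp p hW
  simp only [Function.comp_def] at hWi
  unfold leftVec
  fun_prop

/-- Both fields have zero y-component, so y, and with it the coefficients, is constant along the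
directions of differentiation. The bracket is therefore the one for constant coefficients. -/
theorem lieBracket_leftVec {u v : ℝ → Fin 4 → ℝ} (hu : ContDiff ℝ ∞ u) (hv : ContDiff ℝ ∞ v)
    {p : BundleCoord} (hp : p ∈ domain) :
    VectorField.lieBracket ℝ (fun p : BundleCoord => leftVec p (u p.1))
      (fun p : BundleCoord => leftVec p (v p.1)) p =
      leftVec p (suExtBracket p.1 (u p.1) (v p.1)) := by
  have key : ∀ {u v : ℝ → Fin 4 → ℝ}, ContDiff ℝ ∞ v →
      fderiv ℝ (fun p : BundleCoord => leftVec p (v p.1)) p (leftVec p (u p.1)) =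
        leftVecDeriv p (u p.1) (v p.1) := fun {u v} hv => by
    have h1 := (((contDiffOn_leftVec hv).contDiffAt (isOpen_domain.mem_nhds hp)).differentiableAt
      (by simp)).hasFDerivAt
    have hγ : HasDerivAt (fun t : ℝ => p + t • leftVec p (u p.1)) (leftVec p (u p.1)) 0 := by
      simpa using ((hasDerivAt_id (0 : ℝ)).smul_const (leftVec p (u p.1))).const_add p
    have h2 := h1.comp_hasDerivAt_of_eq (0 : ℝ) hγ (by simp)
    refine h2.unique ((hasDerivAt_leftVec hp (u p.1) (v p.1)).congr_of_eventuallyEq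
      (Eventually.of_forall fun t => ?_))
    have h3 : (p + t • leftVec p (u p.1)).1 = p.1 := by simp [leftVec]
    simp [h3]
  rw [VectorField.lieBracket, key hv, key hu, leftVecDeriv_sub]

end BundleCoord

end CoordinateFormulas

/-! ### The global chart of the bundle -/

section BundleChart

open Complex Set Filter Topology

/-- The norm condition drops out because it is the equation det = 1 for a matrix of this shape. -/
theorem mem_contractionG_iff {y : ℝ} {g : Matrix.SpecialLinearGroup (Fin 2) ℂ} :
    g ∈ contractionG y ↔
      g 0 0 ∈ argSector ∧ g 1 0 = -(y : ℂ) * conj (g 0 1) ∧ g 1 1 = conj (g 0 0) := by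
  constructor
  · rintro ⟨a, b, h, -, h2⟩
    have h3 : ∀ i j, g i j = !![a, b; -(y : ℂ) * conj b, conj a] i j := fun i j => by rw [← h]
    simp only [h3]
    exact ⟨h2, rfl, rfl⟩
  · rintro ⟨h1, h2, h3⟩
    refine ⟨g 0 0, g 0 1, ?_, ?_, h1⟩
    · rw [← h2, ← h3]
      exact Matrix.eta_fin_two _
    · have h := g.det_coe
      rw [Matrix.det_fin_two, h2, h3, mul_conj] at h
      have h4 : g 0 1 * (-(y : ℂ) * conj (g 0 1)) = -(y * normSq (g 0 1) : ℝ) := by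
        push_cast
        rw [← mul_conj]; ring
      rw [h4, sub_neg_eq_add, ← ofReal_add] at h
      rw [← normSq_eq_norm_sq, ← normSq_eq_norm_sq]
      exact_mod_cast h

/-- Matrices of the shape (a, b; -y conj(b), conj(a)) with y fixed are closed under multiplication,
so only the open condition on the argument remains to be checked. -/
theorem mul_mem_contractionG_iff {y : ℝ} {g h : Matrix.SpecialLinearGroup (Fin 2) ℂ}
    (hg : g ∈ contractionG y) (hh : h ∈ contractionG y) :
    g * h ∈ contractionG y ↔ (g * h) 0 0 ∈ argSector := by
  rw [mem_contractionG_iff, and_iff_left]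
  obtain ⟨-, h1, h2⟩ := mem_contractionG_iff.1 hg
  obtain ⟨-, h1', h2'⟩ := mem_contractionG_iff.1 hh
  have e : ∀ i j, (g * h) i j = g i 0 * h 0 j + g i 1 * h 1 j := fun i j => by
    rw [Matrix.SpecialLinearGroup.coe_mul, Matrix.mul_apply, Fin.sum_univ_two]
  simp only [e, h1, h2, h1', h2']
  constructor <;> simp <;> ring

theorem contractionG_entry_eq {y : ℝ} {g : Matrix.SpecialLinearGroup (Fin 2) ℂ}
    (hg : g ∈ contractionG y) : g 0 0 * conj (g 0 0) + y * (g 0 1 * conj (g 0 1)) = 1 := by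
  obtain ⟨-, h2, h3⟩ := mem_contractionG_iff.1 hg
  have h := g.det_coe
  rw [Matrix.det_fin_two, h2, h3] at h
  linear_combination h

/-- The coordinates of a point of `A_ℝ`. -/
noncomputable def contractionCoord (x : contractionBundle) : BundleCoord :=
  (x.1.1, x.1.2.1, arg (x.1.2.2 0 0), x.1.2.2 0 1)

theorem diag_contractionCoord (x : contractionBundle) :
    (contractionCoord x).diag = x.1.2.2 0 0 :=
  diagEntry_eq (contractionG_entry_eq x.2)

theorem contractionCoord_mem_domain (x : contractionBundle) :
    contractionCoord x ∈ BundleCoord.domain := by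
  have h1 := (mem_contractionG_iff.1 x.2).1
  refine ⟨?_, h1.2⟩
  have h2 := contractionG_entry_eq x.2
  rw [mul_conj, mul_conj] at h2
  have h3 : normSq (x.1.2.2 0 0) + x.1.1 * normSq (x.1.2.2 0 1) = 1 := by exact_mod_cast h2
  have h4 := normSq_pos.2 h1.1
  change x.1.1 * normSq (x.1.2.2 0 1) < 1
  linarith

/-- The point of `A_ℝ` with given coordinates. -/
noncomputable def ofContractionCoord (p : BundleCoord.domain) : contractionBundle :=
  ⟨(p.1.1, p.1.2.1, ⟨!![p.1.diag, p.1.2.2.2; -(p.1.1 : ℂ) * conj p.1.2.2.2, conj p.1.diag], by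
      rw [Matrix.det_fin_two_of, BundleCoord.diag_mul_conj p.2]; ring⟩), by
    refine mem_contractionG_iff.2 ⟨?_, rfl, rfl⟩
    exact (diagEntry_mem_argSector p.2.1 p.2.2.1 p.2.2.2).1⟩

theorem contractionCoord_ofContractionCoord (p : BundleCoord.domain) :
    contractionCoord (ofContractionCoord p) = p := by
  have h := (diagEntry_mem_argSector p.2.1 p.2.2.1 p.2.2.2).2
  exact Prod.ext rfl (Prod.ext rfl (Prod.ext h rfl))

theorem contractionBundle_ext {x x' : contractionBundle}
    (h : contractionCoord x = contractionCoord x') : x = x' := by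
  have h1 : x.1.1 = x'.1.1 := congrArg (fun p : BundleCoord => p.1) h
  have h2 : x.1.2.1 = x'.1.2.1 := congrArg (fun p : BundleCoord => p.2.1) h
  have h3 : x.1.2.2 0 1 = x'.1.2.2 0 1 := congrArg (fun p : BundleCoord => p.2.2.2) h
  have h4 : x.1.2.2 0 0 = x'.1.2.2 0 0 := by
    rw [← diag_contractionCoord, ← diag_contractionCoord, h]
  obtain ⟨-, h5, h6⟩ := mem_contractionG_iff.1 x.2
  obtain ⟨-, h5', h6'⟩ := mem_contractionG_iff.1 x'.2
  refine Subtype.ext (Prod.ext h1 (Prod.ext h2 (Matrix.SpecialLinearGroup.ext _ _ fun i j => ?_)))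
  fin_cases i <;> fin_cases j
  · exact h4
  · exact h3
  · exact h5.trans ((by rw [h1, h3]) : _ = _) |>.trans h5'.symm
  · exact h6.trans ((by rw [h4]) : _ = _) |>.trans h6'.symm

theorem continuous_contractionEntry (i j : Fin 2) :
    Continuous fun x : contractionBundle => x.1.2.2 i j := by
  have h : Continuous fun x : contractionBundle =>
      (x.1.2.2 : Matrix (Fin 2) (Fin 2) ℂ) :=
    continuous_subtype_val.comp (continuous_snd.comp (continuous_snd.comp continuous_subtype_val))
  exact h.matrix_elem i j

/-- The set `A_ℝ` is homeomorphic to an open subset of `ℝ × ℝ × ℝ × ℂ`. -/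
noncomputable def contractionHomeomorph : contractionBundle ≃ₜ BundleCoord.domain where
  toFun x := ⟨contractionCoord x, contractionCoord_mem_domain x⟩
  invFun := ofContractionCoord
  left_inv x := contractionBundle_ext (contractionCoord_ofContractionCoord _)
  right_inv p := Subtype.ext (contractionCoord_ofContractionCoord p)
  continuous_toFun := by
    refine Continuous.subtype_mk ?_ _
    refine (continuous_fst.comp continuous_subtype_val).prodMk
      ((continuous_fst.comp (continuous_snd.comp continuous_subtype_val)).prodMk
      (Continuous.prodMk ?_ (continuous_contractionEntry 0 1)))
    refine continuous_iff_continuousAt.2 fun x => ?_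
    exact ContinuousAt.comp (f := fun x : contractionBundle => x.1.2.2 0 0)
      (continuousAt_arg (argSector_subset_slitPlane (mem_contractionG_iff.1 x.2).1))
      (continuous_contractionEntry 0 0).continuousAt
  continuous_invFun := by
    have hd : Continuous fun p : BundleCoord.domain => p.1.diag :=
      continuous_iff_continuousAt.2 fun p =>
        (BundleCoord.contDiffAt_diag p.2).continuousAt.comp continuous_subtype_val.continuousAt
    refine Continuous.subtype_mk (Continuous.prodMk (by fun_prop) (Continuous.prodMk (by fun_prop)
      (Continuous.subtype_mk (continuous_matrix fun i j => ?_) _))) _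
    have hc : Continuous fun z : ℂ => conj z := conjCLE.continuous
    fin_cases i <;> fin_cases j
    · exact hd
    · change Continuous fun p : BundleCoord.domain => p.1.2.2.2
      fun_prop
    · change Continuous fun p : BundleCoord.domain => -(p.1.1 : ℂ) * conj p.1.2.2.2
      have := continuous_ofReal
      fun_prop
    · exact hc.comp hd

/-- A linear identification of the coordinate space with the model space. -/
noncomputable def bundleCoordEquiv : BundleCoord ≃L[ℝ] EuclideanSpace ℝ (Fin 5) :=
  -- Any isomorphism of these five-dimensional real spaces serves; nothing later depends on the
  -- choice.
  ContinuousLinearEquiv.ofFinrankEq (by simp)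

theorem isOpenEmbedding_contractionCoord :
    IsOpenEmbedding fun x : contractionBundle => bundleCoordEquiv (contractionCoord x) :=
  bundleCoordEquiv.toHomeomorph.isOpenEmbedding.comp
    (BundleCoord.isOpen_domain.isOpenEmbedding_subtypeVal.comp contractionHomeomorph.isOpenEmbedding)

instance : Nonempty contractionBundle := ⟨contractionData.unit 0⟩

/-- The global chart of `A_ℝ`. -/
noncomputable def contractionChart :
    OpenPartialHomeomorph contractionBundle (EuclideanSpace ℝ (Fin 5)) :=
  isOpenEmbedding_contractionCoord.toOpenPartialHomeomorph _

theorem contractionChart_apply (x : contractionBundle) :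
    contractionChart x = bundleCoordEquiv (contractionCoord x) := rfl

theorem contractionChart_source : contractionChart.source = univ := rfl

theorem mem_contractionChart_target {q : EuclideanSpace ℝ (Fin 5)} :
    q ∈ contractionChart.target ↔ bundleCoordEquiv.symm q ∈ BundleCoord.domain := by
  have h : contractionChart.target =
      range fun x : contractionBundle => bundleCoordEquiv (contractionCoord x) :=
    isOpenEmbedding_contractionCoord.toOpenPartialHomeomorph_target _
  rw [h]
  constructor
  · rintro ⟨x, rfl⟩
    simpa using contractionCoord_mem_domain x
  · intro hq
    exact ⟨ofContractionCoord ⟨_, hq⟩, by simp [contractionCoord_ofContractionCoord]⟩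

theorem contractionCoord_chart_symm {p : BundleCoord} (hp : p ∈ BundleCoord.domain) :
    contractionCoord (contractionChart.symm (bundleCoordEquiv p)) = p := by
  have h := contractionChart.right_inv
    ((mem_contractionChart_target (q := bundleCoordEquiv p)).2 (by simpa using hp))
  rw [contractionChart_apply] at h
  exact bundleCoordEquiv.injective h

noncomputable instance : ChartedSpace (EuclideanSpace ℝ (Fin 5)) contractionBundle :=
  contractionChart.singletonChartedSpace contractionChart_source

instance : IsManifold (𝓡 5) ∞ contractionBundle :=
  contractionChart.isManifold_singleton contractionChart_source

theorem chartAt_contractionBundle (x : contractionBundle) :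
    chartAt (EuclideanSpace ℝ (Fin 5)) x = contractionChart := rfl

theorem contMDiff_contractionCoord : ContMDiff (𝓡 5) 𝓘(ℝ, BundleCoord) ∞ contractionCoord := by
  have h : ContMDiff (𝓡 5) (𝓡 5) ∞ contractionChart := by
    have := contMDiffOn_chart (I := 𝓡 5) (n := ∞) (x := contractionData.unit 0)
    rwa [chartAt_contractionBundle, contractionChart_source, contMDiffOn_univ] at this
  have h2 := bundleCoordEquiv.symm.contDiff.contMDiff (n := ∞) |>.comp h
  refine h2.congr fun x => ?_
  simp [contractionChart_apply]

/-- A map to `A_ℝ` is smooth if it is smooth in coordinates. -/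
theorem contMDiffWithinAt_contractionBundle {E' H' M' : Type*} [NormedAddCommGroup E']
    [NormedSpace ℝ E'] [TopologicalSpace H'] {J : ModelWithCorners ℝ E' H'} [TopologicalSpace M']
    [ChartedSpace H' M'] {f : M' → contractionBundle} {s : Set M'} {z : M'}
    (hf : ContMDiffWithinAt J 𝓘(ℝ, BundleCoord) ∞ (fun p => contractionCoord (f p)) s z) :
    ContMDiffWithinAt J (𝓡 5) ∞ f s z := by
  have h : ContMDiffOn (𝓡 5) (𝓡 5) ∞ contractionChart.symm contractionChart.target := by
    have := contMDiffOn_chart_symm (I := 𝓡 5) (n := ∞) (x := contractionData.unit 0)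
    rwa [chartAt_contractionBundle] at this
  have h1 : ContMDiffAt (𝓡 5) (𝓡 5) ∞ contractionChart.symm
      (bundleCoordEquiv (contractionCoord (f z))) :=
    h.contMDiffAt (contractionChart.open_target.mem_nhds (mem_contractionChart_target.2
      (by simpa using contractionCoord_mem_domain (f z))))
  have h2 : ContMDiffAt 𝓘(ℝ, BundleCoord) (𝓡 5) ∞ bundleCoordEquiv (contractionCoord (f z)) :=
    bundleCoordEquiv.contDiff.contMDiff.contMDiffAt
  refine ((h1.comp _ h2).comp_contMDiffWithinAt z hf).congr (fun p _ => ?_) ?_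
  all_goals exact (contractionChart.left_inv (mem_univ _)).symm

end BundleChart

/-! ### The cocycle and the bundle of local Lie groups -/

section BundleOperations

open Complex Set Filter Topology

theorem contractionG_mul_apply {y : ℝ} (g : Matrix.SpecialLinearGroup (Fin 2) ℂ)
    {h : Matrix.SpecialLinearGroup (Fin 2) ℂ} (hh : h ∈ contractionG y) :
    (g * h) 0 0 = g 0 0 * h 0 0 - y * (g 0 1 * conj (h 0 1)) ∧
      (g * h) 0 1 = g 0 0 * h 0 1 + g 0 1 * conj (h 0 0) := by
  obtain ⟨-, h1, h2⟩ := mem_contractionG_iff.1 hh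
  have e : ∀ i j, (g * h) i j = g i 0 * h 0 j + g i 1 * h 1 j := fun i j => by
    rw [Matrix.SpecialLinearGroup.coe_mul, Matrix.mul_apply, Fin.sum_univ_two]
  rw [e, e, h1, h2]
  exact ⟨by ring, rfl⟩

theorem contractionG_div_eq {y : ℝ} {g h : Matrix.SpecialLinearGroup (Fin 2) ℂ}
    (hg : g ∈ contractionG y) (hh : h ∈ contractionG y) :
    (g * h) 0 0 / (g 0 0 * h 0 0) =
      1 + y * (-(g 0 1 * conj (h 0 1)) / (g 0 0 * h 0 0)) := by
  have h1 := (mem_contractionG_iff.1 hg).1.1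
  have h2 := (mem_contractionG_iff.1 hh).1.1
  rw [(contractionG_mul_apply g hh).1]
  field_simp
  ring

/-- The two cases of Ω are merged into one expression that is smooth in y, which gives smoothness of
the product across y = 0. -/
theorem contractionOmega_eq {y : ℝ} {g h : Matrix.SpecialLinearGroup (Fin 2) ℂ}
    (hg : g ∈ contractionG y) (hh : h ∈ contractionG y) :
    contractionOmega y g h = imLogQuot y (-(g 0 1 * conj (h 0 1)) / (g 0 0 * h 0 0)) := by
  rw [contractionOmega]
  split_ifs with hy
  · rw [hy, imLogQuot_zero]
  · rw [imLogQuot_of_ne_zero hy, contractionG_div_eq hg hh]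

/-- An exact equality of real numbers, not only modulo 2π: y Ω is the defect of additivity of arg a.
-/
theorem arg_contractionG_mul {y : ℝ} {g h : Matrix.SpecialLinearGroup (Fin 2) ℂ}
    (hg : g ∈ contractionG y) (hh : h ∈ contractionG y) (hgh : g * h ∈ contractionG y) :
    arg ((g * h) 0 0) = arg (g 0 0) + arg (h 0 0) + y * contractionOmega y g h := by
  rw [contractionOmega_eq hg hh, mul_imLogQuot, ← contractionG_div_eq hg hh]
  exact (div_mem_slitPlane_of_mem_argSector (mem_contractionG_iff.1 hg).1
    (mem_contractionG_iff.1 hh).1 (mem_contractionG_iff.1 hgh).1).2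

/-- The function `Ω_y` is a cocycle. -/
theorem contractionOmega_cocycle {y : ℝ} {g h k : Matrix.SpecialLinearGroup (Fin 2) ℂ}
    (hg : g ∈ contractionG y) (hh : h ∈ contractionG y) (hk : k ∈ contractionG y)
    (hgh : g * h ∈ contractionG y) (hhk : h * k ∈ contractionG y)
    (hghk : g * h * k ∈ contractionG y) :
    contractionOmega y g h + contractionOmega y (g * h) k =
      contractionOmega y h k + contractionOmega y g (h * k) := by
  by_cases hy : y = 0
  · subst hy
    have ha := (mem_contractionG_iff.1 hg).1.1
    have hb := (mem_contractionG_iff.1 hh).1.1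
    have hc := (mem_contractionG_iff.1 hk).1.1
    have eb := contractionG_entry_eq hh
    rw [contractionOmega_eq hg hh, contractionOmega_eq hgh hk, contractionOmega_eq hh hk,
      contractionOmega_eq hg hhk]
    simp only [imLogQuot_zero, ← add_im]
    congr 1
    rw [(contractionG_mul_apply g hh).1, (contractionG_mul_apply g hh).2,
      (contractionG_mul_apply h hk).1, (contractionG_mul_apply h hk).2]
    simp only [ofReal_zero, zero_mul, sub_zero, add_zero, map_add, map_mul, conj_conj] at eb ⊢
    -- At y = 0 the diagonal entry of h has modulus 1. With this substitution the identity already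
    -- holds before taking imaginary parts.
    have hb' : conj (h 0 0) = (h 0 0)⁻¹ := eq_inv_of_mul_eq_one_right eb
    rw [hb']
    field_simp
    ring
  -- For y ≠ 0, y Ω is the coboundary of arg a, and the four instances cancel.
  · have h1 := arg_contractionG_mul hg hh hgh
    have h2 := arg_contractionG_mul hgh hk hghk
    have h3 := arg_contractionG_mul hh hk hhk
    have h4 := arg_contractionG_mul hg hhk (by rwa [← mul_assoc])
    rw [← mul_assoc] at h4
    refine mul_left_cancel₀ hy ?_
    linear_combination h3 + h4 - h1 - h2

theorem contractionData_mul_val {x x' : contractionBundle}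
    (h : (x, x') ∈ contractionData.mulDom) :
    (contractionData.mul x x').1 = (x.1.1,
      x.1.2.1 + x'.1.2.1 + contractionOmega x.1.1 x.1.2.2 x'.1.2.2, x.1.2.2 * x'.1.2.2) := by
  simp only [contractionData]
  rw [dif_pos h.2]

/-- The second half is the condition under which the coordinate formula for the product is smooth.
-/
theorem contractionCoord_mul {x x' : contractionBundle}
    (h : (x, x') ∈ contractionData.mulDom) :
    contractionCoord (contractionData.mul x x') =
        (contractionCoord x).mul (contractionCoord x') ∧
      1 + ((contractionCoord x).1 : ℂ) * (contractionCoord x).cocycleArg (contractionCoord x') ∈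
        slitPlane := by
  have hx := x.2
  have hx' := x'.2
  simp only [contractionBundle, mem_ofPred_eq] at hx hx'
  rw [← (h.1 : x.1.1 = x'.1.1)] at hx'
  have hm : x.1.2.2 * x'.1.2.2 ∈ contractionG x.1.1 := h.2
  have hΩ := contractionOmega_eq hx hx'
  have hs := (div_mem_slitPlane_of_mem_argSector (mem_contractionG_iff.1 hx).1
    (mem_contractionG_iff.1 hx').1 (mem_contractionG_iff.1 hm).1).1
  rw [contractionG_div_eq hx hx'] at hs
  have hc : (contractionCoord x).cocycleArg (contractionCoord x') =
      -(x.1.2.2 0 1 * conj (x'.1.2.2 0 1)) / (x.1.2.2 0 0 * x'.1.2.2 0 0) := by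
    rw [BundleCoord.cocycleArg, diag_contractionCoord, diag_contractionCoord]
    rfl
  rw [BundleCoord.mul, hc, diag_contractionCoord, diag_contractionCoord, contractionCoord,
    contractionData_mul_val h]
  refine ⟨?_, hs⟩
  simp only [contractionCoord, Prod.mk.injEq, true_and]
  exact ⟨by rw [hΩ], by rw [arg_contractionG_mul hx hx' hm, hΩ],
    (contractionG_mul_apply _ hx').2⟩

theorem contMDiff_contractionData_proj : ContMDiff (𝓡 5) 𝓘(ℝ, ℝ) ∞ contractionData.proj :=
  ((contDiff_fst (E := ℝ) (F := ℝ × ℝ × ℂ)).contMDiff (n := ∞)).comp contMDiff_contractionCoord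

theorem contMDiff_contractionData_unit : ContMDiff 𝓘(ℝ, ℝ) (𝓡 5) ∞ contractionData.unit := by
  intro y
  refine contMDiffWithinAt_contractionBundle ?_
  have h : (fun y : ℝ => contractionCoord (contractionData.unit y)) =
      fun y : ℝ => ((y, 0, 0, 0) : BundleCoord) := by
    funext y
    simp [contractionCoord, contractionData]
  rw [h]
  exact ContDiff.contMDiff (by fun_prop) y

theorem contMDiffOn_contractionData_mul :
    ContMDiffOn ((𝓡 5).prod (𝓡 5)) (𝓡 5) ∞
      (fun p : contractionBundle × contractionBundle => contractionData.mul p.1 p.2)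
      contractionData.mulDom := by
  intro p hp
  refine contMDiffWithinAt_contractionBundle ?_
  have h1 : ContMDiff ((𝓡 5).prod (𝓡 5)) 𝓘(ℝ, BundleCoord × BundleCoord) ∞
      (fun p : contractionBundle × contractionBundle =>
        (contractionCoord p.1, contractionCoord p.2)) :=
    (contMDiff_contractionCoord.comp contMDiff_fst).prodMk_space
      (contMDiff_contractionCoord.comp contMDiff_snd)
  have h2 : ContMDiffAt 𝓘(ℝ, BundleCoord × BundleCoord) 𝓘(ℝ, BundleCoord) ∞
      (fun q : BundleCoord × BundleCoord => q.1.mul q.2)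
      (contractionCoord p.1, contractionCoord p.2) :=
    (BundleCoord.contDiffAt_mul (contractionCoord_mem_domain _) (contractionCoord_mem_domain _)
      (contractionCoord_mul hp).2).contMDiffAt
  have h3 := h2.comp_contMDiffWithinAt (s := contractionData.mulDom) p
    h1.contMDiffAt.contMDiffWithinAt
  exact h3.congr (fun q hq => (contractionCoord_mul hq).1) (contractionCoord_mul hp).1

theorem contMDiff_contractionData_inv : ContMDiff (𝓡 5) (𝓡 5) ∞ contractionData.inv := by
  intro x
  refine contMDiffWithinAt_contractionBundle ?_
  have h : (fun x => contractionCoord (contractionData.inv x)) =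
      (fun p : BundleCoord => ((p.1, -p.2.1, -p.2.2.1, -p.2.2.2) : BundleCoord)) ∘
        contractionCoord := by
    funext x
    obtain ⟨h1, -, h2⟩ := mem_contractionG_iff.1 x.2
    have h3 : (x.1.2.2)⁻¹ 0 0 = conj (x.1.2.2 0 0) := by
      rw [Matrix.SpecialLinearGroup.coe_inv, Matrix.adjugate_fin_two, ← h2]; rfl
    have h4 : (x.1.2.2)⁻¹ 0 1 = -(x.1.2.2 0 1) := by
      rw [Matrix.SpecialLinearGroup.coe_inv, Matrix.adjugate_fin_two]; rfl
    have h5 : arg (conj (x.1.2.2 0 0)) = -arg (x.1.2.2 0 0) := by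
      rw [arg_conj, if_neg (by linarith [h1.2.2, Real.pi_pos])]
    simp [contractionCoord, contractionData, h3, h4, h5]
  rw [h]
  exact ((ContDiff.contMDiff (by fun_prop)).comp contMDiff_contractionCoord) x

theorem contractionOmega_one_left {y : ℝ} {g : Matrix.SpecialLinearGroup (Fin 2) ℂ}
    (hg : g ∈ contractionG y) : contractionOmega y 1 g = 0 := by
  rw [contractionOmega_eq (one_mem_contractionG y) hg]
  simp [imLogQuot_zero_right]

theorem contractionOmega_one_right {y : ℝ} {g : Matrix.SpecialLinearGroup (Fin 2) ℂ}
    (hg : g ∈ contractionG y) : contractionOmega y g 1 = 0 := by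
  rw [contractionOmega_eq hg (one_mem_contractionG y)]
  simp [imLogQuot_zero_right]

/-- With a(g⁻¹) = conj(a) and b(g⁻¹) = -b, the quotient is 1/|a|² for y ≠ 0 and |b|²/|a|² for y = 0:
a nonnegative real in both cases. -/
theorem contractionOmega_inv_right {y : ℝ} {g : Matrix.SpecialLinearGroup (Fin 2) ℂ}
    (hg : g ∈ contractionG y) : contractionOmega y g g⁻¹ = 0 := by
  obtain ⟨-, -, h2⟩ := mem_contractionG_iff.1 hg
  have h3 : g⁻¹ 0 0 = conj (g 0 0) := by
    rw [Matrix.SpecialLinearGroup.coe_inv, Matrix.adjugate_fin_two, ← h2]; rfl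
  have h4 : g⁻¹ 0 1 = -(g 0 1) := by
    rw [Matrix.SpecialLinearGroup.coe_inv, Matrix.adjugate_fin_two]; rfl
  rw [contractionOmega, h3, h4, mul_inv_cancel, mul_conj]
  split_ifs
  · simp [mul_conj]
  · simp [← ofReal_inv, arg_ofReal_of_nonneg, normSq_nonneg]

theorem contractionChart_mem_maximalAtlas :
    contractionChart ∈ IsManifold.maximalAtlas (𝓡 5) ∞ contractionBundle :=
  IsManifold.chart_mem_maximalAtlas (contractionData.unit 0)

theorem isSubmersion_contractionData_proj :
    Manifold.IsSubmersion (𝓡 5) 𝓘(ℝ, ℝ) ∞ contractionData.proj := by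
  refine Manifold.IsSubmersionOfComplement.isSubmersion (F := ℝ × ℝ × ℂ) fun x => ?_
  -- In coordinates the projection is the first projection of ℝ × (ℝ × ℝ × ℂ).
  refine Manifold.IsSubmersionAtOfComplement.mk_of_charts bundleCoordEquiv.symm contractionChart
    (OpenPartialHomeomorph.refl ℝ) (mem_univ _) (mem_univ _) contractionChart_mem_maximalAtlas
    (StructureGroupoid.id_mem_maximalAtlas _) (fun _ _ => mem_univ _) fun q hq => ?_
  have hq' : q ∈ contractionChart.target := by simpa using hq
  have h := contractionCoord_chart_symm (mem_contractionChart_target.1 hq')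
  rw [ContinuousLinearEquiv.apply_symm_apply] at h
  exact congrArg (fun p : BundleCoord => p.1) h

theorem isLocalLieGroupBundle_contractionData :
    contractionData.IsLocalLieGroupBundle (𝓡 5) 𝓘(ℝ, ℝ) where
  isSubmersion_proj := isSubmersion_contractionData_proj
  contMDiff_proj := contMDiff_contractionData_proj
  contMDiff_unit := contMDiff_contractionData_unit
  proj_unit _ := rfl
  mulDom_open := by
    -- The condition on the diagonal entry of the product makes sense for pairs over different base
    -- points and is open there; on the fibre product it is equivalent to membership in
    -- `contractionG`.
    refine ⟨{p | (p.1.1.2.2 * p.2.1.2.2) 0 0 ∈ argSector}, ?_, ?_⟩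
    · have e : ∀ p : contractionBundle × contractionBundle, (p.1.1.2.2 * p.2.1.2.2) 0 0 =
          p.1.1.2.2 0 0 * p.2.1.2.2 0 0 + p.1.1.2.2 0 1 * p.2.1.2.2 1 0 := fun p => by
        rw [Matrix.SpecialLinearGroup.coe_mul, Matrix.mul_apply, Fin.sum_univ_two]
      simp only [e]
      have hc : ∀ i j, Continuous fun p : contractionBundle × contractionBundle =>
          p.1.1.2.2 i j := fun i j => (continuous_contractionEntry i j).comp continuous_fst
      have hc' : ∀ i j, Continuous fun p : contractionBundle × contractionBundle =>
          p.2.1.2.2 i j := fun i j => (continuous_contractionEntry i j).comp continuous_snd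
      exact isOpen_argSector.preimage
        (((hc 0 0).mul (hc' 0 0)).add ((hc 0 1).mul (hc' 1 0)))
    · ext ⟨x, x'⟩
      have key : x.1.1 = x'.1.1 → (x.1.2.2 * x'.1.2.2 ∈ contractionG x.1.1 ↔
          (x.1.2.2 * x'.1.2.2) 0 0 ∈ argSector) := fun h =>
        mul_mem_contractionG_iff x.2 (by rw [h]; exact x'.2)
      exact ⟨fun h => ⟨(key h.1).1 h.2, h.1⟩, fun h => ⟨h.2, (key h.2).2 h.1⟩⟩
  contMDiffOn_mul := contMDiffOn_contractionData_mul
  proj_mul g h hgh := by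
    have h1 := congrArg (fun x => x.1) (contractionData_mul_val hgh)
    exact h1
  unit_mul g := by
    have h : (contractionData.unit (contractionData.proj g), g) ∈ contractionData.mulDom :=
      ⟨rfl, by simpa only [contractionData, one_mul, mul_one] using (show _ ∈ contractionG _ from g.2)⟩
    refine ⟨h, Subtype.ext ((contractionData_mul_val h).trans ?_)⟩
    have h2 := contractionOmega_one_left g.2
    simp [contractionData, h2]
  mul_unit g := by
    have h : (g, contractionData.unit (contractionData.proj g)) ∈ contractionData.mulDom :=
      ⟨rfl, by simpa only [contractionData, one_mul, mul_one] using (show _ ∈ contractionG _ from g.2)⟩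
    refine ⟨h, Subtype.ext ((contractionData_mul_val h).trans ?_)⟩
    have h2 := contractionOmega_one_right g.2
    simp [contractionData, h2]
  mul_assoc g h k hgh hhk hghk hghk' := by
    refine Subtype.ext ?_
    rw [contractionData_mul_val hghk, contractionData_mul_val hghk', contractionData_mul_val hgh,
      contractionData_mul_val hhk]
    have e1 : g.1.1 = h.1.1 := hgh.1
    have e2 : h.1.1 = k.1.1 := hhk.1
    have hh : h.1.2.2 ∈ contractionG g.1.1 := by rw [e1]; exact h.2
    have hk : k.1.2.2 ∈ contractionG g.1.1 := by rw [e1, e2]; exact k.2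
    have hhk2 : h.1.2.2 * k.1.2.2 ∈ contractionG g.1.1 := by rw [e1]; exact hhk.2
    have h3 := hghk.2
    simp only [contractionData_mul_val hgh] at h3
    have hc := contractionOmega_cocycle g.2 hh hk hgh.2 hhk2 h3
    simp only [Prod.mk.injEq, true_and, mul_assoc, and_true, ← e1]
    linear_combination hc
  isOpen_invDom := isOpen_univ
  unit_mem_invDom _ := mem_univ _
  contMDiffOn_inv := contMDiff_contractionData_inv.contMDiffOn
  inv_mul g _ := by
    have h : (contractionData.inv g, g) ∈ contractionData.mulDom :=
      ⟨rfl, by simpa [contractionData] using one_mem_contractionG _⟩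
    refine ⟨h, Subtype.ext ((contractionData_mul_val h).trans ?_)⟩
    have h2 := contractionOmega_inv_right (inv_mem_contractionG g.2)
    rw [inv_inv] at h2
    simp [contractionData, h2]
  mul_inv g _ := by
    have h : (g, contractionData.inv g) ∈ contractionData.mulDom :=
      ⟨rfl, by simpa [contractionData] using one_mem_contractionG _⟩
    refine ⟨h, Subtype.ext ((contractionData_mul_val h).trans ?_)⟩
    have h2 := contractionOmega_inv_right g.2
    simp [contractionData, h2]

end BundleOperations

/-! ### The bundle as an embedded submanifold -/

section BundleEmbedding

open Complex Set Filter Topology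

theorem mem_maximalAtlas_of_contDiffOn {E : Type*} [NormedAddCommGroup E] [NormedSpace ℝ E]
    {ψ : OpenPartialHomeomorph E E} (h1 : ContDiffOn ℝ ∞ ψ ψ.source)
    (h2 : ContDiffOn ℝ ∞ ψ.symm ψ.target) : ψ ∈ IsManifold.maximalAtlas 𝓘(ℝ, E) ∞ E := by
  refine StructureGroupoid.mem_maximalAtlas_of_mem_groupoid _
    (mem_groupoid_of_pregroupoid.2 ⟨?_, ?_⟩)
  · simpa [contDiffPregroupoid] using h1
  · simpa [contDiffPregroupoid] using h2

/-- The ambient vector space `ℝ × ℝ × M₂(ℂ)`. -/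
abbrev ContractionAmbient := ℝ × ℝ × (Fin 2 → Fin 2 → ℂ)

/-- Coordinates on an open subset of `ℝ × ℝ × M₂(ℂ)` in which `A_ℝ` is a linear slice. -/
noncomputable def sliceCoord (x : ContractionAmbient) : BundleCoord × (ℝ × ℂ × ℂ) :=
  ((x.1, x.2.1, (Complex.log (x.2.2 0 0)).im, x.2.2 0 1),
    ((Complex.log (x.2.2 0 0)).re - Real.log √(1 - x.1 * normSq (x.2.2 0 1)),
      x.2.2 1 0 + x.1 * conj (x.2.2 0 1), x.2.2 1 1 - conj (x.2.2 0 0)))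

/-- The inverse of `sliceCoord`. -/
noncomputable def ofSliceCoord (p : BundleCoord × (ℝ × ℂ × ℂ)) : ContractionAmbient :=
  (p.1.1, p.1.2.1, ![![exp p.2.1 * p.1.diag, p.1.2.2.2],
    ![p.2.2.1 - p.1.1 * conj p.1.2.2.2, p.2.2.2 + conj (exp p.2.1 * p.1.diag)]])

/-- The domain of `sliceCoord`. -/
def sliceSource : Set ContractionAmbient :=
  {x | x.1 * normSq (x.2.2 0 1) < 1 ∧ x.2.2 0 0 ∈ slitPlane}

/-- The range of `sliceCoord`. -/
def sliceTarget : Set (BundleCoord × (ℝ × ℂ × ℂ)) :=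
  {p | p.1.1 * normSq p.1.2.2.2 < 1 ∧ -Real.pi < p.1.2.2.1 ∧ p.1.2.2.1 < Real.pi}

theorem isOpen_sliceSource : IsOpen sliceSource := by
  have h : Continuous fun x : ContractionAmbient => x.1 * normSq (x.2.2 0 1) := by
    have := continuous_normSq
    fun_prop
  have h2 : Continuous fun x : ContractionAmbient => x.2.2 0 0 := by fun_prop
  exact (isOpen_lt h continuous_const).inter (isOpen_slitPlane.preimage h2)

theorem isOpen_sliceTarget : IsOpen sliceTarget := by
  have h : Continuous fun p : BundleCoord × (ℝ × ℂ × ℂ) => p.1.1 * normSq p.1.2.2.2 := by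
    have := continuous_normSq
    fun_prop
  have hθ : Continuous fun p : BundleCoord × (ℝ × ℂ × ℂ) => p.1.2.2.1 := by fun_prop
  exact (isOpen_lt h continuous_const).inter ((isOpen_lt continuous_const hθ).inter
    (isOpen_lt hθ continuous_const))

theorem contDiffOn_sliceCoord : ContDiffOn ℝ ∞ sliceCoord sliceSource := by
  intro x hx
  refine ContDiffAt.contDiffWithinAt ?_
  have he : ∀ i j, ContDiff ℝ ∞ fun x : ContractionAmbient => x.2.2 i j := fun i j => by fun_prop
  have hl : ContDiffAt ℝ ∞ (fun x : ContractionAmbient => Complex.log (x.2.2 0 0)) x :=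
    ContDiffAt.comp (g := Complex.log) x ((contDiffAt_log (n := ∞) hx.2).restrict_scalars ℝ)
      (he 0 0).contDiffAt
  have hre := reCLM.contDiff.contDiffAt.comp x hl
  have him := imCLM.contDiff.contDiffAt.comp x hl
  simp only [Function.comp_def, reCLM_apply, imCLM_apply] at hre him
  have hpos : 0 < 1 - x.1 * normSq (x.2.2 0 1) := by linarith [hx.1]
  have hN : ContDiffAt ℝ ∞
      (fun x : ContractionAmbient => Real.log √(1 - x.1 * normSq (x.2.2 0 1))) x := by
    have h := contDiff_normSq (n := ∞)
    refine ContDiffAt.log (ContDiffAt.sqrt ?_ hpos.ne') (Real.sqrt_pos.2 hpos).ne'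
    fun_prop
  have hc : ContDiff ℝ ∞ (fun z : ℂ => conj z) := conjCLE.contDiff
  have hy : ContDiff ℝ ∞ (fun x : ContractionAmbient => (x.1 : ℂ)) :=
    ofRealCLM.contDiff.comp contDiff_fst
  unfold sliceCoord
  fun_prop

theorem contDiffOn_ofSliceCoord : ContDiffOn ℝ ∞ ofSliceCoord sliceTarget := by
  intro p hp
  refine ContDiffAt.contDiffWithinAt ?_
  have hd : ContDiffAt ℝ ∞ (fun p : BundleCoord × (ℝ × ℂ × ℂ) => p.1.diag) p :=
    (contDiffAt_diagEntry hp.1).comp p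
      (f := fun p : BundleCoord × (ℝ × ℂ × ℂ) => (p.1.1, p.1.2.2.1, p.1.2.2.2)) (by fun_prop)
  have hc : ContDiff ℝ ∞ (fun z : ℂ => conj z) := conjCLE.contDiff
  have ho : ContDiff ℝ ∞ (fun y : ℝ => (y : ℂ)) := ofRealCLM.contDiff
  have hy : ContDiff ℝ ∞ (fun p : BundleCoord × (ℝ × ℂ × ℂ) => (p.1.1 : ℂ)) :=
    ho.comp (contDiff_fst.comp contDiff_fst)
  have he : ContDiff ℝ ∞ (fun p : BundleCoord × (ℝ × ℂ × ℂ) => exp (p.2.1 : ℂ)) :=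
    (ho.comp (contDiff_fst.comp contDiff_snd)).cexp
  have hm : ContDiffAt ℝ ∞ (fun p : BundleCoord × (ℝ × ℂ × ℂ) =>
      (![![exp p.2.1 * p.1.diag, p.1.2.2.2],
        ![p.2.2.1 - p.1.1 * conj p.1.2.2.2, p.2.2.2 + conj (exp p.2.1 * p.1.diag)]] :
        Fin 2 → Fin 2 → ℂ)) p := by
    refine contDiffAt_pi.2 fun i => contDiffAt_pi.2 fun j => ?_
    fin_cases i <;> fin_cases j <;> simp <;> fun_prop
  unfold ofSliceCoord
  fun_prop

theorem ofSliceCoord_sliceCoord {x : ContractionAmbient} (hx : x ∈ sliceSource) :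
    ofSliceCoord (sliceCoord x) = x := by
  have hpos : 0 < √(1 - x.1 * normSq (x.2.2 0 1)) := Real.sqrt_pos.2 (by linarith [hx.1])
  have h : exp ((sliceCoord x).2.1) * (sliceCoord x).1.diag = x.2.2 0 0 := by
    have h1 : (√(1 - x.1 * normSq (x.2.2 0 1)) : ℂ) =
        exp (Real.log √(1 - x.1 * normSq (x.2.2 0 1)) : ℝ) := by
      rw [← ofReal_exp, Real.exp_log hpos]
    simp only [sliceCoord, BundleCoord.diag, diagEntry]
    rw [h1, ← exp_add, ← exp_add]
    conv_rhs => rw [← exp_log (slitPlane_ne_zero hx.2), ← re_add_im (Complex.log (x.2.2 0 0))]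
    congr 1
    push_cast
    ring
  refine Prod.ext rfl (Prod.ext rfl ?_)
  funext i j
  simp only [ofSliceCoord, h]
  fin_cases i <;> fin_cases j <;> simp [sliceCoord]

theorem sliceCoord_ofSliceCoord {p : BundleCoord × (ℝ × ℂ × ℂ)} (hp : p ∈ sliceTarget) :
    ofSliceCoord p ∈ sliceSource ∧ sliceCoord (ofSliceCoord p) = p := by
  have hpos : 0 < √(1 - p.1.1 * normSq p.1.2.2.2) := Real.sqrt_pos.2 (by linarith [hp.1])
  have h : exp p.2.1 * p.1.diag =
      exp ((p.2.1 + Real.log √(1 - p.1.1 * normSq p.1.2.2.2) : ℝ) + p.1.2.2.1 * I) := by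
    rw [exp_add, ofReal_add, exp_add, ← ofReal_exp (Real.log _), Real.exp_log hpos]
    simp [BundleCoord.diag, diagEntry, mul_assoc]
  -- The entry is the exponential of a number with imaginary part θ in (-π, π), so the principal
  -- logarithm recovers that number.
  have hl : Complex.log (exp p.2.1 * p.1.diag) =
      (p.2.1 + Real.log √(1 - p.1.1 * normSq p.1.2.2.2) : ℝ) + p.1.2.2.1 * I := by
    rw [h, log_exp] <;> simp [hp.2.1, hp.2.2.le]
  refine ⟨⟨hp.1, ?_⟩, ?_⟩
  · have h2 : arg (exp p.2.1 * p.1.diag) = p.1.2.2.1 := by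
      rw [← log_im, hl]; simp
    refine mem_slitPlane_iff_arg.2 ⟨?_, ?_⟩
    · exact h2.trans_ne hp.2.2.ne
    · change exp p.2.1 * p.1.diag ≠ 0
      rw [h]; exact exp_ne_zero _
  · have hl' : Complex.log ((ofSliceCoord p).2.2 0 0) =
      (p.2.1 + Real.log √(1 - p.1.1 * normSq p.1.2.2.2) : ℝ) + p.1.2.2.1 * I := hl
    simp only [sliceCoord, hl']
    ext <;> simp [ofSliceCoord]

/-- The chart of `ℝ × ℝ × M₂(ℂ)` given by `sliceCoord`. -/
noncomputable def sliceHomeomorph :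
    OpenPartialHomeomorph ContractionAmbient (BundleCoord × (ℝ × ℂ × ℂ)) where
  toFun := sliceCoord
  invFun := ofSliceCoord
  source := sliceSource
  target := sliceTarget
  map_source' _ hx := ⟨hx.1, neg_pi_lt_log_im _,
    (log_im _).trans_lt ((arg_le_pi _).lt_of_ne (mem_slitPlane_iff_arg.1 hx.2).1)⟩
  map_target' _ hp := (sliceCoord_ofSliceCoord hp).1
  left_inv' _ hx := ofSliceCoord_sliceCoord hx
  right_inv' _ hp := (sliceCoord_ofSliceCoord hp).2
  open_source := isOpen_sliceSource
  open_target := isOpen_sliceTarget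
  continuousOn_toFun := contDiffOn_sliceCoord.continuousOn
  continuousOn_invFun := contDiffOn_ofSliceCoord.continuousOn

/-- A linear identification of the model space of the slice chart with the ambient space. -/
noncomputable def sliceEquiv :
    (EuclideanSpace ℝ (Fin 5) × (ℝ × ℂ × ℂ)) ≃L[ℝ] ContractionAmbient :=
  ContinuousLinearEquiv.ofFinrankEq (by simp [Module.finrank_pi_fintype])

/-- A chart of the ambient space in which `A_ℝ` is a linear slice. -/
noncomputable def sliceChart : OpenPartialHomeomorph ContractionAmbient ContractionAmbient :=
  sliceHomeomorph.transHomeomorph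
    ((bundleCoordEquiv.prodCongr (ContinuousLinearEquiv.refl ℝ (ℝ × ℂ × ℂ))).trans
      sliceEquiv).toHomeomorph

theorem sliceChart_mem_maximalAtlas :
    sliceChart ∈ IsManifold.maximalAtlas 𝓘(ℝ, ContractionAmbient) ∞ ContractionAmbient := by
  refine mem_maximalAtlas_of_contDiffOn ?_ ?_
  · exact ((bundleCoordEquiv.prodCongr (ContinuousLinearEquiv.refl ℝ (ℝ × ℂ × ℂ))).trans
      sliceEquiv).contDiff.comp_contDiffOn contDiffOn_sliceCoord
  · exact contDiffOn_ofSliceCoord.comp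
      ((bundleCoordEquiv.prodCongr (ContinuousLinearEquiv.refl ℝ (ℝ × ℂ × ℂ))).trans
      sliceEquiv).symm.contDiff.contDiffOn (fun q hq => hq)

theorem contractionIncl_mem_sliceSource (x : contractionBundle) :
    contractionIncl x ∈ sliceSource :=
  ⟨(contractionCoord_mem_domain x).1,
    argSector_subset_slitPlane (mem_contractionG_iff.1 x.2).1⟩

/-- The three transverse coordinates vanish by |a|² = 1 - y|b|² and by the two relations that
express the second row through the first. -/
theorem sliceCoord_contractionIncl (x : contractionBundle) :
    sliceCoord (contractionIncl x) = (contractionCoord x, 0) := by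
  obtain ⟨h0, h1, h2⟩ := mem_contractionG_iff.1 x.2
  have h3 := contractionG_entry_eq x.2
  rw [mul_conj, mul_conj] at h3
  have h4 : normSq (x.1.2.2 0 0) = 1 - x.1.1 * normSq (x.1.2.2 0 1) := by
    rw [eq_sub_iff_add_eq]; exact_mod_cast h3
  refine Prod.ext (Prod.ext rfl (Prod.ext rfl (Prod.ext (log_im _) rfl)))
    (Prod.ext ?_ (Prod.ext ?_ ?_))
  · change (Complex.log (x.1.2.2 0 0)).re - Real.log √(1 - x.1.1 * normSq (x.1.2.2 0 1)) = 0
    rw [log_re, ← h4, normSq_eq_norm_sq, Real.sqrt_sq (norm_nonneg _), sub_self]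
  · change x.1.2.2 1 0 + x.1.1 * conj (x.1.2.2 0 1) = 0
    rw [h1]; ring
  · change x.1.2.2 1 1 - conj (x.1.2.2 0 0) = 0
    rw [h2, sub_self]

theorem isSmoothEmbedding_contractionIncl :
    Manifold.IsSmoothEmbedding (𝓡 5) 𝓘(ℝ, ContractionAmbient) ∞ contractionIncl where
  isImmersion := by
    refine Manifold.IsImmersionOfComplement.isImmersion (F := ℝ × ℂ × ℂ) fun x => ?_
    refine Manifold.IsImmersionAtOfComplement.mk_of_charts sliceEquiv contractionChart
      sliceChart (mem_univ _) (contractionIncl_mem_sliceSource x)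
      contractionChart_mem_maximalAtlas sliceChart_mem_maximalAtlas
      (fun x _ => contractionIncl_mem_sliceSource x) fun q hq => ?_
    have hq' : q ∈ contractionChart.target := by simpa using hq
    have h := contractionCoord_chart_symm (mem_contractionChart_target.1 hq')
    rw [ContinuousLinearEquiv.apply_symm_apply] at h
    have h2 := sliceCoord_contractionIncl (contractionChart.symm q)
    rw [h] at h2
    change sliceEquiv (bundleCoordEquiv (sliceCoord (contractionIncl (contractionChart.symm q))).1,
      (sliceCoord (contractionIncl (contractionChart.symm q))).2) = sliceEquiv (q, 0)
    rw [h2, ContinuousLinearEquiv.apply_symm_apply]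
  isEmbedding :=
    -- The topology of `A_ℝ` is by definition the subspace topology, and that of SL(2, ℂ) comes from
    -- the matrices.
    (IsEmbedding.id.prodMap (IsEmbedding.id.prodMap IsEmbedding.subtypeVal)).comp
      IsEmbedding.subtypeVal

end BundleEmbedding

/-! ### The Lie algebroid of the bundle -/

section BundleAlgebroid

open Complex Set Filter Topology

/-- Brackets are natural under linear isomorphisms. This moves the computation from `BundleCoord` to
the model space of the chart. -/
theorem lieBracket_conj {E F : Type*} [NormedAddCommGroup E] [NormedSpace ℝ E]
    [NormedAddCommGroup F] [NormedSpace ℝ F] (L : E ≃L[ℝ] F) (V W : E → E) (p : E) :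
    VectorField.lieBracket ℝ (fun q => L (V (L.symm q))) (fun q => L (W (L.symm q))) (L p) =
      L (VectorField.lieBracket ℝ V W p) := by
  have key : ∀ W : E → E, fderiv ℝ (fun q => L (W (L.symm q))) (L p) =
      (L : E →L[ℝ] F).comp ((fderiv ℝ W p).comp (L.symm : F →L[ℝ] E)) := fun W => by
    have h1 := L.comp_fderiv (f := fun q => W (L.symm q)) (x := L p)
    have h2 := L.symm.comp_right_fderiv (f := W) (x := L p)
    simp only [Function.comp_def, L.symm_apply_apply] at h1 h2
    rw [h1, h2]
  simp [VectorField.lieBracket, key]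

theorem contractionCoord_unit (y : ℝ) :
    contractionCoord (contractionData.unit y) = (y, 0, 0, 0) := by
  simp [contractionCoord, contractionData]

/-- Straight lines in the chart of `A_ℝ` are straight lines in coordinates, for small times. -/
theorem eventually_contractionCoord_line (x : contractionBundle) (p : BundleCoord) :
    ∀ᶠ t : ℝ in 𝓝 0, contractionCoord (contractionChart.symm
      (contractionChart x + t • bundleCoordEquiv p)) = contractionCoord x + t • p := by
  have hγ : Continuous fun t : ℝ => contractionCoord x + t • p := by fun_prop
  have h := hγ.continuousAt.eventually_mem (x := 0)
    (BundleCoord.isOpen_domain.mem_nhds (by simpa using contractionCoord_mem_domain x))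
  filter_upwards [h] with t ht
  rw [contractionChart_apply, ← map_smul, ← map_add, contractionCoord_chart_symm ht]

/-- The defining derivative is taken within a fibre, so it is evaluated along a straight line in the
chart through the unit. There left translation is `BundleCoord.mul`, whose derivative is known. -/
theorem contractionData_leftInvariantField (u : ℝ → Fin 4 → ℝ)
    (ξ : ∀ y : ℝ, TangentSpace (𝓡 5) (contractionData.unit y))
    (hξ : ∀ y, (ξ y : EuclideanSpace ℝ (Fin 5)) =
      bundleCoordEquiv (BundleCoord.unitVec (u y))) (x : contractionBundle) :
    (contractionData.leftInvariantField (𝓡 5) ξ x : EuclideanSpace ℝ (Fin 5)) =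
      bundleCoordEquiv ((contractionCoord x).leftVec (u (contractionCoord x).1)) := by
  let o := contractionData.unit (contractionData.proj x)
  have hxo : (x, o) ∈ contractionData.mulDom :=
    (isLocalLieGroupBundle_contractionData.mul_unit x).1
  have hf : MDifferentiableWithinAt (𝓡 5) (𝓡 5) (contractionData.mul x)
      {h | (x, h) ∈ contractionData.mulDom} o := by
    have h1 : ContMDiffWithinAt (𝓡 5) ((𝓡 5).prod (𝓡 5)) ∞
        (fun h : contractionBundle => (x, h)) {h | (x, h) ∈ contractionData.mulDom} o :=
      (contMDiff_const.prodMk contMDiff_id).contMDiffAt.contMDiffWithinAt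
    exact ((contMDiffOn_contractionData_mul (x, o) hxo).comp o h1
      (fun h hh => hh)).mdifferentiableWithinAt (by simp)
  have hline := eventually_contractionCoord_line o
    (BundleCoord.unitVec (u (contractionCoord x).1))
  have ho : contractionCoord o = ((contractionCoord x).1, 0, 0, 0) := contractionCoord_unit _
  -- The line stays in the fibre because `unitVec` has zero y-component, and in the domain of
  -- multiplication for small t because that domain is open in the fibre product.
  have hs : ∀ᶠ t : ℝ in 𝓝 0, (x, contractionChart.symm (contractionChart o +
      t • bundleCoordEquiv (BundleCoord.unitVec (u (contractionCoord x).1)))) ∈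
        contractionData.mulDom := by
    obtain ⟨W, hW, hWe⟩ := isLocalLieGroupBundle_contractionData.mulDom_open
    rw [hWe] at hxo ⊢
    have hc : ContinuousAt (fun t : ℝ => (x, contractionChart.symm (contractionChart o +
        t • bundleCoordEquiv (BundleCoord.unitVec (u (contractionCoord x).1))))) 0 := by
      refine continuousAt_const.prodMk (ContinuousAt.comp (g := contractionChart.symm) ?_ ?_)
      · refine contractionChart.continuousAt_symm ?_
        simpa using contractionChart.map_source (mem_univ o)
      · fun_prop
    have h0 : contractionChart.symm (contractionChart o + (0 : ℝ) •
        bundleCoordEquiv (BundleCoord.unitVec (u (contractionCoord x).1))) = o := by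
      rw [zero_smul, add_zero]
      exact contractionChart.left_inv (mem_univ o)
    filter_upwards [hline, hc.eventually_mem (hW.mem_nhds (by rw [h0]; exact hxo.1))] with t h1 h2
    refine ⟨h2, ?_⟩
    have h3 := congrArg (fun p : BundleCoord => p.1) h1
    rw [ho] at h3
    simp only [BundleCoord.unitVec_apply, Prod.fst_add, Prod.smul_fst, smul_zero, add_zero] at h3
    exact h3.symm
  have hd : HasDerivAt (fun t : ℝ => contractionChart (contractionData.mul x
      (contractionChart.symm (contractionChart o +
        t • bundleCoordEquiv (BundleCoord.unitVec (u (contractionCoord x).1))))))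
      (bundleCoordEquiv ((contractionCoord x).leftVec (u (contractionCoord x).1))) 0 := by
    refine (bundleCoordEquiv.toContinuousLinearMap.hasFDerivAt.comp_hasDerivAt (0 : ℝ)
      (BundleCoord.hasDerivAt_mul (contractionCoord_mem_domain x)
        (u (contractionCoord x).1))).congr_of_eventuallyEq ?_
    filter_upwards [hline, hs] with t h1 h2
    rw [contractionChart_apply, (contractionCoord_mul h2).1, h1, ho]
    rfl
  refine Eq.trans ?_ (mfderivWithin_eq_of_hasDerivAt chartAt_contractionBundle
    chartAt_contractionBundle hf hs hd)
  exact congrArg _ (hξ _)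

theorem mfderiv_contractionData_proj (x : contractionBundle) (p : BundleCoord) :
    (mfderiv (𝓡 5) 𝓘(ℝ, ℝ) contractionData.proj x : EuclideanSpace ℝ (Fin 5) →L[ℝ] ℝ)
      (bundleCoordEquiv p) = p.1 := by
  refine mfderiv_eq_of_hasDerivAt chartAt_contractionBundle (fun _ => chartAt_self_eq)
    (contMDiff_contractionData_proj.mdifferentiableAt (by simp)) ?_
  have h : HasDerivAt (fun t : ℝ => (contractionCoord x).1 + t * p.1) p.1 0 := by
    simpa using ((hasDerivAt_id (0 : ℝ)).mul_const p.1).const_add (contractionCoord x).1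
  refine h.congr_of_eventuallyEq ?_
  filter_upwards [eventually_contractionCoord_line x p] with t ht
  exact congrArg (fun p : BundleCoord => p.1) ht

/-- The isomorphism of `𝔄_ℝ` with the Lie algebroid of `A_ℝ`, at the point `y`. -/
noncomputable def contractionIso (y : ℝ) : Bundle.Trivial ℝ (Fin 4 → ℝ) y →ₗ[ℝ]
    TangentSpace (𝓡 5) (contractionData.unit y) :=
  (bundleCoordEquiv.toLinearMap ∘ₗ BundleCoord.unitVec :
    (Fin 4 → ℝ) →ₗ[ℝ] EuclideanSpace ℝ (Fin 5))

theorem contDiff_section {F : Type*} [NormedAddCommGroup F] [NormedSpace ℝ F]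
    (X : Cₛ^∞⟮𝓘(ℝ, ℝ); F, Bundle.Trivial ℝ F⟯) : ContDiff ℝ ∞ (fun y : ℝ => (X y : F)) :=
  contDiff_iff_contDiffAt.2 fun y =>
    ((Bundle.contMDiffAt_section _).1 (X.contMDiff y)).contDiffAt

theorem contMDiff_trivial_snd :
    ContMDiff (𝓘(ℝ, ℝ).prod 𝓘(ℝ, Fin 4 → ℝ)) 𝓘(ℝ, Fin 4 → ℝ) ∞
      (fun p : Bundle.TotalSpace (Fin 4 → ℝ) (Bundle.Trivial ℝ (Fin 4 → ℝ)) =>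
        (p.snd : Fin 4 → ℝ)) :=
  fun p => (Bundle.contMDiffAt_totalSpace.1 (contMDiffAt_id (x := p))).2

theorem isLieAlgebroidIso_contractionIso :
    contractionData.IsLieAlgebroidIso (I := 𝓡 5) suExtAlgebroid contractionIso where
  contMDiff := fun p => by
    refine contMDiffAt_tangentBundle_of_chartAt_eq chartAt_contractionBundle
      (f := fun p : Bundle.TotalSpace (Fin 4 → ℝ) (Bundle.Trivial ℝ (Fin 4 → ℝ)) =>
        contractionData.unit p.proj)
      (v := fun p => bundleCoordEquiv (BundleCoord.unitVec p.snd)) ?_ ?_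
    · exact (contMDiff_contractionData_unit.comp (Bundle.contMDiff_proj _)) p
    · have h : ContDiff ℝ ∞ fun u : Fin 4 → ℝ => bundleCoordEquiv (BundleCoord.unitVec u) :=
        (bundleCoordEquiv.toContinuousLinearMap.comp
          (LinearMap.toContinuousLinearMap BundleCoord.unitVec)).contDiff
      exact (h.contMDiff.comp contMDiff_trivial_snd) p
  injective b := bundleCoordEquiv.injective.comp BundleCoord.unitVec_injective
  range_eq b w := by
    obtain ⟨p, rfl⟩ := bundleCoordEquiv.surjective w
    have h : mfderiv (𝓡 5) 𝓘(ℝ, ℝ) contractionData.proj (contractionData.unit b)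
        (bundleCoordEquiv p) = p.1 := mfderiv_contractionData_proj _ p
    constructor
    · rintro ⟨v, hv⟩
      have hv' : BundleCoord.unitVec v = p := bundleCoordEquiv.injective hv
      refine h.trans ?_
      rw [← hv']
      rfl
    · intro hw
      obtain ⟨u, hu⟩ := BundleCoord.exists_unitVec_eq (h.symm.trans hw)
      exact ⟨u, congrArg bundleCoordEquiv hu⟩
  anchor_eq b v := mfderiv_contractionData_proj _ (BundleCoord.unitVec v)
  contMDiff_leftInvariantField X x := by
    have hX := contDiff_section X
    have hf : ContMDiffAt (𝓡 5) (𝓡 5) ∞ (fun x : contractionBundle =>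
        bundleCoordEquiv ((contractionCoord x).leftVec (X (contractionCoord x).1))) x := by
      have h1 : ContDiffAt ℝ ∞ (fun p : BundleCoord => bundleCoordEquiv (p.leftVec (X p.1)))
          (contractionCoord x) :=
        bundleCoordEquiv.contDiff.contDiffAt.comp _
          ((BundleCoord.contDiffOn_leftVec hX).contDiffAt
            (BundleCoord.isOpen_domain.mem_nhds (contractionCoord_mem_domain x)))
      exact h1.contMDiffAt.comp x contMDiff_contractionCoord.contMDiffAt
    refine (contMDiffAt_tangentBundle_of_chartAt_eq chartAt_contractionBundle
      (f := fun x : contractionBundle => x) contMDiffAt_id hf).congr_of_eventuallyEq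
      (Eventually.of_forall fun z => ?_)
    exact congrArg (Bundle.TotalSpace.mk z)
      (contractionData_leftInvariantField X _ (fun y => rfl) z)
  bracket_eq X Y x := by
    refine (mlieBracket_eq_lieBracket chartAt_contractionBundle
      (fun q => bundleCoordEquiv ((bundleCoordEquiv.symm q).leftVec
        (X (bundleCoordEquiv.symm q).1)))
      (fun q => bundleCoordEquiv ((bundleCoordEquiv.symm q).leftVec
        (Y (bundleCoordEquiv.symm q).1))) x _ _ ?_ ?_).trans ?_
    · intro z
      rw [contractionChart_apply, ContinuousLinearEquiv.symm_apply_apply]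
      exact contractionData_leftInvariantField X _ (fun y => rfl) z
    · intro z
      rw [contractionChart_apply, ContinuousLinearEquiv.symm_apply_apply]
      exact contractionData_leftInvariantField Y _ (fun y => rfl) z
    · refine Eq.trans ?_ (contractionData_leftInvariantField
        (fun y => suExtBracket y (X y) (Y y)) _ (fun y => rfl) x).symm
      rw [contractionChart_apply]
      refine (lieBracket_conj bundleCoordEquiv (fun p : BundleCoord => p.leftVec (X p.1))
        (fun p : BundleCoord => p.leftVec (Y p.1)) (contractionCoord x)).trans ?_
      exact congrArg bundleCoordEquiv (BundleCoord.lieBracket_leftVec (contDiff_section X)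
        (contDiff_section Y) (contractionCoord_mem_domain x))

/-- At the unit, a' = i u₁ and b' = u₂ + i u₃; the second row follows from the shape of the matrix.
The basis vectors then give the prescribed matrices. -/
theorem mfderiv_contractionIncl_contractionIso (y : ℝ) (u : Fin 4 → ℝ) :
    (mfderiv (𝓡 5) 𝓘(ℝ, ContractionAmbient) contractionIncl (contractionData.unit y) :
      EuclideanSpace ℝ (Fin 5) →L[ℝ] ContractionAmbient)
        (bundleCoordEquiv (BundleCoord.unitVec u)) =
      (0, u 0, ![![u 1 * I, u 2 + u 3 * I],
        ![-(y : ℂ) * conj (u 2 + u 3 * I : ℂ), conj (u 1 * I : ℂ)]]) := by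
  refine mfderiv_eq_of_hasDerivAt chartAt_contractionBundle (fun _ => chartAt_self_eq)
    (isSmoothEmbedding_contractionIncl.contMDiff.mdifferentiableAt (by simp)) ?_
  have hb : HasDerivAt (fun t : ℝ => (t : ℂ) * (u 2 + u 3 * I)) (u 2 + u 3 * I) 0 := by
    simpa using (hasDerivAt_id (0 : ℝ)).ofReal_comp.mul_const (u 2 + u 3 * I : ℂ)
  have ha : HasDerivAt (fun t : ℝ => diagEntry y (t * u 1) (t * (u 2 + u 3 * I))) (u 1 * I) 0 := by
    have h := hasDerivAt_diagEntry (y := y) 0 (u 1) (b := 0) (u 2 + u 3 * I) (by simp)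
    simpa [diagEntry] using h
  have hr : HasDerivAt (fun t : ℝ => t * u 0) (u 0) 0 := by
    simpa using (hasDerivAt_id (0 : ℝ)).mul_const (u 0)
  have hconj : ∀ {f : ℝ → ℂ} {f' : ℂ}, HasDerivAt f f' 0 →
      HasDerivAt (fun t => conj (f t)) (conj f') 0 := fun h =>
    conjCLE.toContinuousLinearMap.hasFDerivAt.comp_hasDerivAt (0 : ℝ) h
  have hm : HasDerivAt (fun t : ℝ => (![![diagEntry y (t * u 1) (t * (u 2 + u 3 * I)),
      t * (u 2 + u 3 * I)], ![-(y : ℂ) * conj (t * (u 2 + u 3 * I) : ℂ),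
        conj (diagEntry y (t * u 1) (t * (u 2 + u 3 * I)))]] : Fin 2 → Fin 2 → ℂ))
      ![![u 1 * I, u 2 + u 3 * I],
        ![-(y : ℂ) * conj (u 2 + u 3 * I : ℂ), conj (u 1 * I : ℂ)]] 0 := by
    refine hasDerivAt_pi.2 fun i => hasDerivAt_pi.2 fun j => ?_
    fin_cases i <;> fin_cases j
    · exact ha
    · exact hb
    · exact (hconj hb).const_mul _
    · exact hconj ha
  refine ((hasDerivAt_const (0 : ℝ) y).prodMk (hr.prodMk hm)).congr_of_eventuallyEq ?_
  filter_upwards [eventually_contractionCoord_line (contractionData.unit y)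
    (BundleCoord.unitVec u)] with t ht
  obtain ⟨z, hz⟩ : ∃ z, z = contractionChart.symm (contractionChart (contractionData.unit y) +
    t • bundleCoordEquiv (BundleCoord.unitVec u)) := ⟨_, rfl⟩
  rw [← hz, contractionCoord_unit] at ht
  rw [← hz]
  have ht' : contractionCoord z = (y, t * u 0, t * u 1, t * (u 2 + u 3 * I)) := by
    rw [ht]
    ext <;> simp [BundleCoord.unitVec_apply, mul_add]
  have h1 : z.1.1 = y := congrArg (fun p : BundleCoord => p.1) ht'
  have h2 : z.1.2.1 = t * u 0 := congrArg (fun p : BundleCoord => p.2.1) ht'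
  have h3 : z.1.2.2 0 1 = t * (u 2 + u 3 * I) := congrArg (fun p : BundleCoord => p.2.2.2) ht'
  have h4 : z.1.2.2 0 0 = diagEntry y (t * u 1) (t * (u 2 + u 3 * I)) := by
    rw [← diag_contractionCoord, ht', BundleCoord.diag]
  obtain ⟨-, h5, h6⟩ := mem_contractionG_iff.1 z.2
  rw [h3, h1] at h5
  rw [h4] at h6
  refine Prod.ext h1 (Prod.ext h2 ?_)
  funext i j
  fin_cases i <;> fin_cases j
  · exact h4
  · exact h3
  · exact h5
  · exact h6

end BundleAlgebroid

theorem mainTheorem5 :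
    ∃ (_ : ChartedSpace (EuclideanSpace ℝ (Fin 5)) contractionBundle)
      (_ : IsManifold (𝓡 5) ∞ contractionBundle),
      Manifold.IsSmoothEmbedding (𝓡 5) 𝓘(ℝ, ℝ × ℝ × (Fin 2 → Fin 2 → ℂ)) ∞ contractionIncl ∧
      contractionData.IsLocalLieGroupBundle (𝓡 5) 𝓘(ℝ, ℝ) ∧
      ∃ Φ : ∀ y : ℝ, Bundle.Trivial ℝ (Fin 4 → ℝ) y →ₗ[ℝ]
          TangentSpace (𝓡 5) (contractionData.unit y),
        contractionData.IsLieAlgebroidIso suExtAlgebroid Φ ∧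
        ∀ (y : ℝ) (i : Fin 4),
          mfderiv (𝓡 5) 𝓘(ℝ, ℝ × ℝ × (Fin 2 → Fin 2 → ℂ)) contractionIncl
              (contractionData.unit y) (Φ y (suExtBasis i)) =
            ((0 : ℝ), contractionTangent y i) := by
  refine ⟨inferInstance, inferInstance, isSmoothEmbedding_contractionIncl,
    isLocalLieGroupBundle_contractionData, contractionIso, isLieAlgebroidIso_contractionIso,
    fun y i => (mfderiv_contractionIncl_contractionIso y (suExtBasis i)).trans ?_⟩
  refine Prod.ext rfl ?_
  fin_cases i <;> simp [contractionTangent, suExtBasis, mul_comm Complex.I]
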